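/- Let $G$ be a real reductive group, i.e. a Lie group which is a finite covering of an open subgroup of the group of real points of a reductive linear algebraic group defined over $\mathbb R$. Let $K$ be a maximal compact subgroup of $G$, let $\theta$ be a Cartan involution of $G$ with fixed point set $K$, and let $\mathfrak g_0=\mathfrak k_0\oplus\mathfrak p_0$ be the decomposition of the Lie algebra of $G$ into the $+1$- and $-1$-eigenspaces of the differential of $\theta$. Let $B$ be an $\mathrm{Ad}(G)$-invariant symmetric bilinear form on $\mathfrak g_0$ that is negative definite on $\mathfrak k_0$ and positive definite on $\mathfrak p_0=\mathfrak k_0^{\perp}$. Let $\mathfrak p=\mathfrak p_0\otimes_{\mathbb R}\mathbb C$ with the non-degenerate complex quadratic form $q$ induced by $B$, let $SO(\mathfrak p)$ be its complex special orthogonal group, and let $Spin(\mathfrak p)$ be the complex spin group, i.e. the group of products of an even number of vectors $v\in\mathfrak p$ with $q(v)=1$ in the Clifford algebra of $q$ (in which $v^2=-q(v)$). The map $x\mapsto(v\mapsto xvx^{-1})$ is a double covering $Spin(\mathfrak p)\to SO(\mathfrak p)$. Assume that the adjoint action of $K$ on $\mathfrak p$ defines a homomorphism $\mathrm{Ad}:K\to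 SO(\mathfrak p)$ (that is, it has determinant one). If $\mathrm{Ad}:K\to SO(\mathfrak p)$ does not factor over $Spin(\mathfrak p)\to SO(\mathfrak p)$ (as a composition with a continuous homomorphism $K\to Spin(\mathfrak p)$), then there is a double covering $\beta:\tilde G\to G$ of Lie groups (a surjective smooth covering homomorphism whose kernel has two elements) such that, with $\tilde K=\beta^{-1}(K)$, the induced homomorphism $\mathrm{Ad}\circ\beta|_{\tilde K}:\tilde K\to SO(\mathfrak p)$ factors over $Spin(\mathfrak p)\to SO(\mathfrak p)$, by a continuous homomorphism $\tilde K\to Spin(\mathfrak p)$. Moreover, the kernel of $\beta$ lies in the center of $\tilde G$. -/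

import Mathlib

open scoped Manifold ContDiff TensorProduct Matrix

universe u

noncomputable section

namespace DoubleCover

/-! ### The adjoint representation of a Lie group -/

section LieGroups

variable (d : ℕ) {G : Type u} [TopologicalSpace G] [Group G]
  [ChartedSpace (EuclideanSpace ℝ (Fin d)) G]

/-- The differential at the identity of a map `f : G → G` that fixes the identity, as an
endomorphism of the Lie algebra `𝔤₀ = T₁ G`. -/
def diffOne (f : G → G) : Module.End ℝ (GroupLieAlgebra (𝓡 d) G) where
  toFun v := (mfderiv (𝓡 d) (𝓡 d) f 1 : EuclideanSpace ℝ (Fin d) →L[ℝ] EuclideanSpace ℝ (Fin d)) v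
  map_add' v w := ContinuousLinearMap.map_add (mfderiv (𝓡 d) (𝓡 d) f 1) v w
  map_smul' c v := ContinuousLinearMap.map_smul (mfderiv (𝓡 d) (𝓡 d) f 1) c v

theorem diffOne_id : diffOne d (fun x : G => x) = 1 := by
  ext v : 1
  change (mfderiv (𝓡 d) (𝓡 d) (id : G → G) 1) v = v
  rw [mfderiv_id]
  rfl

theorem diffOne_comp {f g : G → G} (hf : ContMDiff (𝓡 d) (𝓡 d) ∞ f)
    (hg : ContMDiff (𝓡 d) (𝓡 d) ∞ g) (hf1 : f 1 = 1) :
    diffOne d (fun x => g (f x)) = diffOne d g * diffOne d f := by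
  ext v : 1
  have hg' : MDifferentiableAt (𝓡 d) (𝓡 d) g 1 := (hg 1).mdifferentiableAt (by simp)
  have hf' : MDifferentiableAt (𝓡 d) (𝓡 d) f 1 := (hf 1).mdifferentiableAt (by simp)
  change (mfderiv (𝓡 d) (𝓡 d) (g ∘ f) 1) v = _
  rw [mfderiv_comp_of_eq hg' hf' hf1]
  change (mfderiv (𝓡 d) (𝓡 d) g (f 1)) (mfderiv (𝓡 d) (𝓡 d) f 1 v)
    = (mfderiv (𝓡 d) (𝓡 d) g 1) (mfderiv (𝓡 d) (𝓡 d) f 1 v)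
  rw [hf1]

variable [LieGroup (𝓡 d) ∞ G]

theorem contMDiff_conj (g : G) : ContMDiff (𝓡 d) (𝓡 d) ∞ (fun x : G => g * x * g⁻¹) :=
  (contMDiff_const.mul contMDiff_id).mul contMDiff_const

/-- The adjoint representation `Ad : G → GL(𝔤₀)`: `Ad(g)` is the differential at the identity of
`x ↦ g x g⁻¹`. -/
def Ad : Representation ℝ G (GroupLieAlgebra (𝓡 d) G) where
  toFun g := diffOne d (fun x => g * x * g⁻¹)
  map_one' := by simpa using diffOne_id d (G := G)
  map_mul' g h := by
    rw [← diffOne_comp d (contMDiff_conj d h) (contMDiff_conj d g) (by simp)]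
    congr 1
    funext x
    group

/-! ### Real reductive groups, Cartan involutions and the Cartan decomposition -/

/-- A subgroup of `GL(n, ℝ)` is real algebraic if it is cut out by a set of real polynomials
in the matrix entries. -/
def IsRealAlgebraic {n : ℕ} (H : Subgroup (GL (Fin n) ℝ)) : Prop :=
  ∃ S : Set (MvPolynomial (Fin n × Fin n) ℝ),
    ∀ g : GL (Fin n) ℝ, g ∈ H ↔ ∀ f ∈ S, MvPolynomial.eval (fun ij => g.1 ij.1 ij.2) f = 0

/-- A realization of the Lie group `G` as a real reductive group: a Lie group homomorphism
`π : G → GL(n, ℝ)` which is a finite covering of an open subgroup of a reductive real algebraic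
group. A real algebraic group is reductive iff in suitable coordinates of `ℝⁿ` it is stable under
transposition; the coordinates are chosen so. -/
structure IsRealization {n : ℕ} (π : G →* GL (Fin n) ℝ) : Prop where
  /-- `π` is smooth. -/
  smooth : ∀ i j, ContMDiff (𝓡 d) 𝓘(ℝ, ℝ) ∞ (fun g => (π g).1 i j)
  /-- `π` is an immersion at the identity (hence everywhere). -/
  immersion : ∀ v : GroupLieAlgebra (𝓡 d) G,
    (∀ i j, mfderiv (𝓡 d) 𝓘(ℝ, ℝ) (fun g => (π g).1 i j) 1 v = 0) → v = 0
  /-- `π` is a covering of its image. -/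
  covering : IsCoveringMap π.rangeRestrict
  /-- The covering is finite. -/
  finite_ker : Finite π.ker
  /-- The image is an open subgroup of a real algebraic group stable under transposition. -/
  open_range : ∃ H : Subgroup (GL (Fin n) ℝ), IsRealAlgebraic H ∧
    (∀ g ∈ H, ∃ h ∈ H, h.1 = g.1ᵀ) ∧ π.range ≤ H ∧ IsOpen {h : H | h.1 ∈ π.range}

/-- `K` is a maximal compact subgroup of the real reductive group `G`, and `θ` is a Cartan
involution of `G` with fixed point set `K`: an involutive automorphism of the Lie group `G` which in
some realization `π` of `G` lies over `g ↦ (gᵗ)⁻¹`. In particular `G` is a real reductive group. -/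
structure IsCartanInvolution (K : Subgroup G) (θ : G ≃* G) : Prop where
  maximal_compact : Maximal (fun L : Subgroup G => IsCompact (L : Set G)) K
  smooth : ContMDiff (𝓡 d) (𝓡 d) ∞ θ
  involutive : Function.Involutive θ
  fixed : ∀ g, θ g = g ↔ g ∈ K
  realization : ∃ (n : ℕ) (π : G →* GL (Fin n) ℝ), IsRealization d π ∧
    ∀ g, (π (θ g)).1 = ((π g)⁻¹).1ᵀ

/-- `𝔨₀`, the Lie algebra of the fixed point group `K` of `θ`: the `+1`-eigenspace of the
differential of `θ`. -/
def k₀ (θ : G ≃* G) : Submodule ℝ (GroupLieAlgebra (𝓡 d) G) :=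
  Module.End.eigenspace (diffOne d θ) 1

/-- `𝔭₀`, the `-1`-eigenspace of the differential of `θ`. -/
def p₀ (θ : G ≃* G) : Submodule ℝ (GroupLieAlgebra (𝓡 d) G) :=
  Module.End.eigenspace (diffOne d θ) (-1)

/-- The symmetric bilinear forms `B` on `𝔤₀` that are `Ad(G)`-invariant, negative definite on `𝔨₀`
and positive definite on `𝔭₀`, where `𝔭₀` is the orthocomplement of `𝔨₀`. -/
structure IsInvariantForm (θ : G ≃* G)
    (B : LinearMap.BilinForm ℝ (GroupLieAlgebra (𝓡 d) G)) : Prop where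
  symm : ∀ X Y, B X Y = B Y X
  invariant : ∀ (g : G) (X Y), B (Ad d g X) (Ad d g Y) = B X Y
  neg_def : ∀ X ∈ k₀ d θ, X ≠ 0 → B X X < 0
  pos_def : ∀ X ∈ p₀ d θ, X ≠ 0 → 0 < B X X
  orthogonal : ∀ Y, Y ∈ p₀ d θ ↔ ∀ X ∈ k₀ d θ, B X Y = 0

variable {d} {K : Subgroup G} {θ : G ≃* G}

theorem Ad_mem_p₀ (h : IsCartanInvolution d K θ) (k : K) {X : GroupLieAlgebra (𝓡 d) G}
    (hX : X ∈ p₀ d θ) : Ad d k.1 X ∈ p₀ d θ := by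
  have hk : θ k.1 = k.1 := (h.fixed k.1).2 k.2
  have key : diffOne d θ * Ad d k.1 = Ad d k.1 * diffOne d θ := by
    change diffOne d θ * diffOne d _ = diffOne d _ * diffOne d θ
    rw [← diffOne_comp d (contMDiff_conj d k.1) h.smooth (by simp),
      ← diffOne_comp d h.smooth (contMDiff_conj d k.1) (by simp)]
    congr 1
    funext x
    simp [hk]
  have hX' : diffOne d θ X = (-1 : ℝ) • X := Module.End.mem_eigenspace_iff.1 hX
  refine Module.End.mem_eigenspace_iff.2 ?_
  have := LinearMap.congr_fun key X
  rw [Module.End.mul_apply, Module.End.mul_apply, hX', map_smul] at this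
  exact this

/-- The adjoint representation of `K` on `𝔭₀`. -/
def AdReal (h : IsCartanInvolution d K θ) : Representation ℝ K (p₀ d θ) where
  toFun k := (Ad d k.1).restrict fun _ hX => Ad_mem_p₀ h k hX
  map_one' := by ext X; simp
  map_mul' k l := by ext X; simp

variable (d θ) in
/-- `𝔭`, the complexification of `𝔭₀`. -/
abbrev P : Type := ℂ ⊗[ℝ] p₀ d θ

/-- The adjoint representation of `K` on `𝔭`. -/
def AdP (h : IsCartanInvolution d K θ) : Representation ℂ K (P d θ) where
  toFun k := (AdReal h k).baseChange ℂ
  map_one' := by rw [map_one]; exact LinearMap.baseChange_id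
  map_mul' k l := by rw [map_mul]; exact LinearMap.baseChange_comp _ _

variable (θ) in
/-- The non-degenerate complex quadratic form `q` on `𝔭` given by (the complexification of) `B`. -/
def q (B : LinearMap.BilinForm ℝ (GroupLieAlgebra (𝓡 d) G)) : QuadraticForm ℂ (P d θ) :=
  QuadraticForm.baseChange ℂ (B.restrict (p₀ d θ)).toQuadraticMap

variable (d) in
/-- `β : G' → G` is a double covering of Lie groups. -/
structure IsDoubleCovering {G' : Type u} [TopologicalSpace G'] [Group G']
    [ChartedSpace (EuclideanSpace ℝ (Fin d)) G'] (β : G' →* G) : Prop where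
  covering : IsCoveringMap β
  localDiffeo : IsLocalDiffeomorph (𝓡 d) (𝓡 d) ∞ β
  surjective : Function.Surjective β
  card_ker : Nat.card β.ker = 2

end LieGroups

/-! ### The complex spin group -/

section SpinGroups

variable {V : Type*} [AddCommGroup V] [Module ℂ V] (q : QuadraticForm ℂ V)

/-- The complex special orthogonal group `SO(q)`. -/
def SO : Submonoid (Module.End ℂ V) where
  carrier := {f | (∀ v, q (f v) = q v) ∧ LinearMap.det f = 1}
  one_mem' := by simp
  mul_mem' := by
    rintro f g ⟨hf, hf'⟩ ⟨hg, hg'⟩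
    exact ⟨fun v => by rw [Module.End.mul_apply, hf, hg], by rw [map_mul, hf', hg', one_mul]⟩

/-- The Clifford algebra of `q` with the sign convention `v ^ 2 = -q(v)`. -/
abbrev Cl : Type _ := CliffordAlgebra (-q)

/-- The canonical topology of the (finite-dimensional, if `V` is) complex vector space `Cl q`. -/
instance : TopologicalSpace (Cl q) := moduleTopology ℂ (Cl q)

/-- The complex spin group: the products of even length of vectors `v` and inverses of vectors,
with `q(v) ≠ 0`, of spinor norm one. Over `ℂ` these are exactly the products of an even number of
vectors `v` with `q(v) = 1`. -/
abbrev Spin : Submonoid (Cl q) := spinGroup (-q)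

theorem ι_injective : Function.Injective (CliffordAlgebra.ι (-q)) := by
  intro v w h
  have := congrArg (CliffordAlgebra.equivExterior (-q)) h
  simpa [CliffordAlgebra.changeForm_ι, CliffordAlgebra.equivExterior] using this

theorem exists_spin_act (x : Spin q) (v : V) :
    ∃ w, CliffordAlgebra.ι (-q) w = x.1 * CliffordAlgebra.ι (-q) v * (x⁻¹).1 := by
  have := spinGroup.conjAct_smul_ι_mem_range_ι (Q := -q) (x := spinGroup.toUnits x) x.2 v
  exact this

/-- The vector `x.v = x v x⁻¹`. -/
def spinActVec (x : Spin q) (v : V) : V := (exists_spin_act q x v).choose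

theorem ι_spinActVec (x : Spin q) (v : V) :
    CliffordAlgebra.ι (-q) (spinActVec q x v) = x.1 * CliffordAlgebra.ι (-q) v * (x⁻¹).1 :=
  (exists_spin_act q x v).choose_spec

/-- The action `x.v = x v x⁻¹` of `Spin(q)` on `V`. It takes values in `SO(q)` if `q` is
non-degenerate (and `V` is finite-dimensional). -/
def spinAct : Representation ℂ (Spin q) V where
  toFun x :=
    { toFun := spinActVec q x
      map_add' := fun v w => ι_injective q <| by
        simp only [map_add, ι_spinActVec, mul_add, add_mul]
      map_smul' := fun c v => ι_injective q <| by
        simp only [map_smul, ι_spinActVec, RingHom.id_apply, mul_smul_comm, smul_mul_assoc] }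
  map_one' := LinearMap.ext fun v => ι_injective q <| by
    change CliffordAlgebra.ι (-q) (spinActVec q 1 v) = CliffordAlgebra.ι (-q) v
    rw [ι_spinActVec]
    simp
  map_mul' x y := LinearMap.ext fun v => ι_injective q <| by
    change CliffordAlgebra.ι (-q) (spinActVec q (x * y) v) =
      CliffordAlgebra.ι (-q) (spinActVec q x (spinActVec q y v))
    simp only [ι_spinActVec, mul_inv_rev, Submonoid.coe_mul, mul_assoc]

/-- The homomorphism `ρ` from the topological group `L` to linear maps (in practice into `SO(q)`)
factors over `Spin(q) → SO(q)`: there is a continuous homomorphism `φ : L → Spin(q)` whose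
composition with `Spin(q) → SO(q)` is `ρ`. -/
def FactorsOverSpin {L : Type*} [Group L] [TopologicalSpace L] (ρ : Representation ℂ L V) : Prop :=
  ∃ φ : L →* Spin q, Continuous φ ∧ (spinAct q).comp φ = ρ

end SpinGroups

end DoubleCover

end

/-!
In coordinates `𝔤₀ ≅ ℝⁿ × W` that turn `B` into `‖v‖² - ‖w‖²`, all operators `Ad g` lie in the
monoid `M` of operators preserving the cone `‖w‖ < ‖v‖`. The upper left block of such an operator is
invertible; let `r : M → O(n)` be its orthogonal factor in the QR decomposition. On the submonoid
`N` of the operators that preserve `‖v‖`, which contains `Ad K`, the map `r` is multiplicative, and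
the identity of `M` is homotopic, along the fibres of `r` and preserving `N`, to a map into `N`. So
the defect `r(ab) (r(a) r(b))⁻¹` is homotopic to `1` relative to `N × N` and lifts to a map `c` into
the pin group that is `1` on `N × N`. Uniqueness of lifts makes `c` a twisted cocycle, whence a
group law `(g, x) (h, y) = (gh, c(Ad g, Ad h) x y)` on the pullback of the pin covering along
`r ∘ Ad`. Over `K` the second projection is a homomorphism to the pin group, and it takes values in
the spin group because `K` acts on `𝔭₀` with determinant one.
-/

noncomputable section

namespace DoubleCover

/-! ### Clifford algebras -/

section Clifford

open CliffordAlgebra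

variable {R M ι : Type*} [Field R] [AddCommGroup M] [Module R M]

section Euler

variable [Fintype ι] (E : Module.Basis ι R M)

/-- The Euler operator `x ↦ ∑ eᵢ ∧ (eⁱ ⌋ x)` of the exterior algebra, which multiplies the elements
of degree `k` by `k`. -/
def euler : Module.End R (ExteriorAlgebra R M) :=
  ∑ i, LinearMap.mulLeft R (ExteriorAlgebra.ι R (E i)) ∘ₗ
    contractLeft (Q := (0 : QuadraticForm R M)) (E.coord i)

theorem euler_apply (x : ExteriorAlgebra R M) :
    euler E x = ∑ i, ExteriorAlgebra.ι R (E i) *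
      contractLeft (Q := (0 : QuadraticForm R M)) (E.coord i) x := by
  simp [euler]

theorem euler_ι_mul (v : M) (x : ExteriorAlgebra R M) :
    euler E (ExteriorAlgebra.ι R v * x)
      = ExteriorAlgebra.ι R v * x + ExteriorAlgebra.ι R v * euler E x := by
  have expand : ∑ i, E.coord i v • ExteriorAlgebra.ι R (E i) = ExteriorAlgebra.ι R v := by
    conv_rhs => rw [← E.sum_repr v, map_sum]
    simp only [map_smul, Module.Basis.coord_apply]
  have anticomm (i : ι) : ExteriorAlgebra.ι R (E i) * ExteriorAlgebra.ι R v
      = -(ExteriorAlgebra.ι R v * ExteriorAlgebra.ι R (E i)) :=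
    eq_neg_of_add_eq_zero_left (ExteriorAlgebra.ι_add_mul_swap _ _)
  have contract (i : ι) :
      contractLeft (Q := (0 : QuadraticForm R M)) (E.coord i) (ExteriorAlgebra.ι R v * x)
        = E.coord i v • x - ExteriorAlgebra.ι R v * contractLeft (E.coord i) x :=
    contractLeft_ι_mul (Q := 0) _ _ _
  simp only [euler_apply, contract, mul_sub, mul_smul_comm, ← mul_assoc, anticomm, neg_mul,
    sub_neg_eq_add, Finset.sum_add_distrib, Finset.mul_sum]
  simp only [← smul_mul_assoc, ← Finset.sum_mul, expand]

theorem euler_of_mem_exteriorPower {k : ℕ} {x : ExteriorAlgebra R M} (hx : x ∈ ⋀[R]^k M) :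
    euler E x = (k : R) • x := by
  induction hx using Submodule.pow_induction_on_left' with
  | algebraMap r => simp [euler_apply, contractLeft_algebraMap]
  | add x y i _ _ ihx ihy => rw [map_add, ihx, ihy, smul_add]
  | mem_mul m hm i x _ ih =>
    obtain ⟨v, rfl⟩ := hm
    rw [euler_ι_mul, ih, mul_smul_comm, Nat.cast_succ, add_smul, one_smul, add_comm]

theorem decompose_euler (x : ExteriorAlgebra R M) (k : ℕ) :
    (DirectSum.decompose (fun i => ⋀[R]^i M) (euler E x) k : ExteriorAlgebra R M)
      = (k : R) • (DirectSum.decompose (fun i => ⋀[R]^i M) x k : ExteriorAlgebra R M) := by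
  induction x using DirectSum.Decomposition.inductionOn (fun i => ⋀[R]^i M) with
  | zero => simp
  | @homogeneous j m =>
    have hm := (⋀[R]^j M).smul_mem (j : R) m.2
    rw [euler_of_mem_exteriorPower E m.2]
    obtain rfl | hjk := eq_or_ne j k
    · rw [DirectSum.decompose_of_mem_same (fun i => ⋀[R]^i M) hm,
        DirectSum.decompose_of_mem_same (fun i => ⋀[R]^i M) m.2]
    · rw [DirectSum.decompose_of_mem_ne (fun i => ⋀[R]^i M) hm hjk,
        DirectSum.decompose_of_mem_ne (fun i => ⋀[R]^i M) m.2 hjk, smul_zero]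
  | add x y hx hy =>
    simp only [map_add, DirectSum.decompose_add, DirectSum.add_apply, Submodule.coe_add, smul_add,
      hx, hy]

theorem mem_range_algebraMap_of_euler_eq_zero [CharZero R] {x : ExteriorAlgebra R M}
    (h : euler E x = 0) : x ∈ (algebraMap R (ExteriorAlgebra R M)).range := by
  classical
  have component_eq_zero (k : ℕ) (hk : k ≠ 0) :
      (DirectSum.decompose (fun i => ⋀[R]^i M) x k : ExteriorAlgebra R M) = 0 := by
    have hkx := decompose_euler E x k
    rw [h, DirectSum.decompose_zero, DirectSum.zero_apply, Submodule.coe_zero] at hkx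
    exact (smul_eq_zero.1 hkx.symm).resolve_left (Nat.cast_ne_zero.2 hk)
  have hx : x = (DirectSum.decompose (fun i => ⋀[R]^i M) x 0 : ExteriorAlgebra R M) := by
    conv_lhs => rw [← DirectSum.sum_support_decompose (fun i => ⋀[R]^i M) x]
    exact Finset.sum_eq_single 0 (fun k _ hk => component_eq_zero k hk) fun h0 => by simpa using h0
  have hmem : x ∈ ⋀[R]^0 M := hx ▸ (DirectSum.decompose (fun i => ⋀[R]^i M) x 0).2
  rw [ExteriorAlgebra.exteriorPower, pow_zero] at hmem
  exact Submodule.mem_one.1 hmem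

end Euler

theorem finite_cliffordAlgebra [Invertible (2 : R)] [Module.Finite R M] (Q : QuadraticForm R M) :
    Module.Finite R (CliffordAlgebra Q) :=
  have : Module.Finite R (ExteriorAlgebra R M) :=
    Module.Finite.of_basis (Module.finBasis R M).ExteriorAlgebra
  Module.Finite.equiv (equivExterior Q).symm

theorem mem_range_algebraMap_of_contractLeft_eq_zero [Finite ι] [CharZero R] [Invertible (2 : R)]
    (E : Module.Basis ι R M) {Q : QuadraticForm R M} {x : CliffordAlgebra Q}
    (h : ∀ i, contractLeft (E.coord i) x = 0) :
    x ∈ (algebraMap R (CliffordAlgebra Q)).range := by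
  cases nonempty_fintype ι
  have hcontract (i : ι) : contractLeft (Q := (0 : QuadraticForm R M)) (E.coord i)
      (equivExterior Q x) = 0 := by
    have := changeForm_contractLeft (changeForm.associated_neg_proof (Q := Q)) (E.coord i) x
    rw [h i, map_zero] at this
    exact this.symm
  obtain ⟨c, hc⟩ := mem_range_algebraMap_of_euler_eq_zero E (x := equivExterior Q x)
    (by simp only [euler_apply, hcontract, mul_zero, Finset.sum_const_zero])
  refine ⟨c, (equivExterior Q).injective ?_⟩
  rw [← hc]
  exact changeForm_algebraMap (changeForm.associated_neg_proof (Q := Q)) c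

theorem ι_mul_sub_involute_mul_ι {Q : QuadraticForm R M} (v : M) (x : CliffordAlgebra Q) :
    CliffordAlgebra.ι Q v * x - involute x * CliffordAlgebra.ι Q v
      = contractLeft (Q.polarBilin v) x := by
  induction x using CliffordAlgebra.left_induction with
  | algebraMap r => simp [Algebra.commutes, contractLeft_algebraMap]
  | add x y hx hy => rw [map_add, map_add, ← hx, ← hy, mul_add, add_mul]; abel
  | ι_mul x m hx =>
    rw [contractLeft_ι_mul, ← hx, map_mul, involute_ι, QuadraticMap.polarBilin_apply_apply,
      Algebra.smul_def, ← CliffordAlgebra.ι_mul_ι_add_swap]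
    noncomm_ring

theorem mem_range_algebraMap_of_graded_comm [Finite ι] [CharZero R] [Invertible (2 : R)]
    (E : Module.Basis ι R M) {Q : QuadraticForm R M} {a : R} (ha : a ≠ 0)
    (hE : ∀ i, Q.polarBilin (E i) = a • E.coord i) {x : CliffordAlgebra Q}
    (h : ∀ i, involute x * CliffordAlgebra.ι Q (E i) = CliffordAlgebra.ι Q (E i) * x) :
    x ∈ (algebraMap R (CliffordAlgebra Q)).range := by
  refine mem_range_algebraMap_of_contractLeft_eq_zero E fun i => ?_
  have hi := ι_mul_sub_involute_mul_ι (E i) x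
  rw [h i, sub_self, hE i, map_smul, LinearMap.smul_apply] at hi
  exact (smul_eq_zero.1 hi.symm).resolve_left ha

theorem mem_even_of_involute_eq [Invertible (2 : R)] {Q : QuadraticForm R M} {x : CliffordAlgebra Q}
    (h : involute x = x) : x ∈ CliffordAlgebra.even Q := by
  have hx : x ∈ evenOdd Q 0 ⊔ evenOdd Q 1 := (evenOdd_isCompl Q).sup_eq_top ▸ trivial
  obtain ⟨y, hy, z, hz, rfl⟩ := Submodule.mem_sup.1 hx
  rw [map_add, involute_eq_of_mem_even hy, involute_eq_of_mem_odd hz] at h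
  have hz2 : (2 : R) • z = 0 := by
    rw [two_smul]
    nth_rewrite 1 [← add_left_cancel h]
    exact neg_add_cancel z
  rw [(smul_eq_zero.1 hz2).resolve_left (Invertible.ne_zero 2), add_zero]
  exact hy

end Clifford

section CliffordTopology

variable {V : Type*} [AddCommGroup V] [Module ℂ V] [FiniteDimensional ℂ V] (q : QuadraticForm ℂ V)

instance : IsModuleTopology ℂ (Cl q) := ⟨rfl⟩

instance : Module.Finite ℂ (Cl q) := finite_cliffordAlgebra _

instance : IsTopologicalRing (Cl q) := IsModuleTopology.isTopologicalRing ℂ _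

instance : ContinuousSMul ℂ (Cl q) := IsModuleTopology.toContinuousSMul ℂ _

instance : T2Space (Cl q) :=
  let e := (Module.finBasis ℂ (Cl q)).equivFun
  T2Space.of_injective_continuous e.injective
    (IsModuleTopology.continuous_of_linearMap e.toLinearMap)

instance : ContinuousStar (Cl q) :=
  ⟨(IsModuleTopology.continuous_of_linearMap (CliffordAlgebra.reverse (Q := -q))).comp
    (IsModuleTopology.continuous_of_linearMap (CliffordAlgebra.involute (Q := -q)).toLinearMap)⟩

end CliffordTopology

/-! ### The pin covering of the orthogonal group -/

section Pin

open CliffordAlgebra Topology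
open scoped InnerProductSpace Pointwise

/-- The orthogonal group of `ℝⁿ`. -/
abbrev Orth (n : ℕ) : Type :=
  unitary (EuclideanSpace ℝ (Fin n) →L[ℝ] EuclideanSpace ℝ (Fin n))

variable {n : ℕ} {V : Type*} [AddCommGroup V] [Module ℂ V] {q : QuadraticForm ℂ V}

local notation "𝔽" => EuclideanSpace ℝ (Fin n)

instance : ContinuousStar (EuclideanSpace ℝ (Fin n) →L[ℝ] EuclideanSpace ℝ (Fin n)) :=
  ⟨ContinuousLinearMap.adjoint.continuous⟩

section Reflection

/-- The reflection of `ℝⁿ` in the hyperplane orthogonal to `u`. -/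
def hyperplaneReflection (u : EuclideanSpace ℝ (Fin n)) : Orth n :=
  Unitary.linearIsometryEquiv.symm (ℝ ∙ u)ᗮ.reflection

theorem hyperplaneReflection_apply {u : 𝔽} (hu : ‖u‖ = 1) (v : 𝔽) :
    (hyperplaneReflection u).1 v = v - (2 * ⟪u, v⟫_ℝ) • u := by
  change (ℝ ∙ u)ᗮ.reflection v = _
  rw [Submodule.reflection_orthogonal_apply, Submodule.reflection_singleton_apply, hu]
  simp [two_smul, two_mul, add_smul]

theorem hyperplaneReflection_mul_self (u : 𝔽) :
    hyperplaneReflection u * hyperplaneReflection u = 1 := by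
  rw [hyperplaneReflection, ← map_mul, Submodule.reflection_mul_reflection, map_one]

theorem hyperplaneReflection_zero : hyperplaneReflection (0 : 𝔽) = 1 := by
  rw [hyperplaneReflection, ← map_one Unitary.linearIsometryEquiv.symm]
  congr 1
  ext1 v
  exact Submodule.reflection_mem_subspace_eq_self (by simp)

theorem hyperplaneReflection_smul {c : ℝ} (hc : c ≠ 0) (u : 𝔽) :
    hyperplaneReflection (c • u) = hyperplaneReflection u := by
  simp only [hyperplaneReflection, Submodule.span_singleton_smul_eq (isUnit_iff_ne_zero.2 hc) u]

theorem det_hyperplaneReflection {u : 𝔽} (hu : u ≠ 0) :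
    LinearMap.det ((hyperplaneReflection u).1 : 𝔽 →ₗ[ℝ] 𝔽) = -1 := by
  change LinearMap.det ((ℝ ∙ u)ᗮ.reflection).toLinearMap = -1
  rw [Submodule.det_reflection, Submodule.orthogonal_orthogonal, finrank_span_singleton hu, pow_one]

theorem continuous_hyperplaneReflection :
    Continuous fun u : Metric.sphere (0 : 𝔽) 1 => hyperplaneReflection u.1 := by
  have h (u : Metric.sphere (0 : 𝔽) 1) : (hyperplaneReflection u.1).1
      = 1 - (2 : ℝ) • (innerSL ℝ u.1).smulRight u.1 := by
    ext1 v
    rw [hyperplaneReflection_apply (norm_eq_of_mem_sphere u)]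
    simp [smul_smul]
  have hcont : Continuous fun u : 𝔽 => (innerSL ℝ u).smulRight u :=
    ((ContinuousLinearMap.smulRightL ℝ 𝔽 𝔽).continuous.comp (innerSL ℝ).continuous).clm_apply
      continuous_id
  refine Continuous.subtype_mk ?_ _
  change Continuous fun u : Metric.sphere (0 : 𝔽) 1 => (hyperplaneReflection u.1).1
  simp only [h]
  exact continuous_const.sub ((hcont.comp continuous_subtype_val).const_smul (2 : ℝ))

theorem exists_prod_hyperplaneReflection (a : Orth n) :
    ∃ l : List 𝔽, l.length ≤ n ∧ a = (l.map hyperplaneReflection).prod := by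
  obtain ⟨l, hl, ha⟩ := (Unitary.linearIsometryEquiv a).reflections_generate_dim
  refine ⟨l, by simpa using hl, Unitary.linearIsometryEquiv.injective ?_⟩
  rw [ha, map_list_prod, List.map_map]
  simp only [hyperplaneReflection, Function.comp_def, MulEquiv.apply_symm_apply]

end Reflection

section RealVectors

/-- `E` is an orthonormal basis for the complex quadratic form `q`. -/
def IsOrthonormalFor (q : QuadraticForm ℂ V) (E : Module.Basis (Fin n) ℂ V) : Prop :=
  ∀ x : Fin n → ℂ, q (∑ i, x i • E i) = ∑ i, x i ^ 2

/-- The vector with the given real coordinates in the basis `E`. -/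
def realVec (E : Module.Basis (Fin n) ℂ V) : EuclideanSpace ℝ (Fin n) →ₗ[ℝ] V where
  toFun v := ∑ i, (v i : ℂ) • E i
  map_add' v w := by simp [add_smul, Finset.sum_add_distrib]
  map_smul' c v := by simp [mul_smul, Finset.smul_sum]

theorem realVec_apply (E : Module.Basis (Fin n) ℂ V) (v : 𝔽) :
    realVec E v = ∑ i, (v i : ℂ) • E i := rfl

theorem realVec_single (E : Module.Basis (Fin n) ℂ V) (i : Fin n) :
    realVec E (EuclideanSpace.single i 1) = E i := by
  simp [realVec]

variable (q) in
/-- The inclusion of the vectors with real coordinates in the Clifford algebra. -/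
def γ (E : Module.Basis (Fin n) ℂ V) : EuclideanSpace ℝ (Fin n) →ₗ[ℝ] Cl q :=
  (CliffordAlgebra.ι (-q)).restrictScalars ℝ ∘ₗ realVec E

variable {E : Module.Basis (Fin n) ℂ V}

theorem γ_apply (v : 𝔽) : γ q E v = CliffordAlgebra.ι (-q) (realVec E v) := rfl

theorem γ_smul (c : ℝ) (v : 𝔽) : γ q E (c • v) = (c : ℂ) • γ q E v :=
  map_smul (γ q E) c v

theorem continuous_γ [FiniteDimensional ℂ V] : Continuous (γ q E) := by
  have h : ⇑(γ q E) = fun v => ∑ i, (v i : ℂ) • CliffordAlgebra.ι (-q) (E i) := by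
    funext v
    rw [γ_apply, realVec_apply, map_sum]
    simp only [map_smul]
  rw [h]
  fun_prop

theorem apply_realVec (hE : IsOrthonormalFor q E) (v : 𝔽) :
    q (realVec E v) = ((‖v‖ ^ 2 : ℝ) : ℂ) := by
  rw [realVec_apply, hE, EuclideanSpace.norm_sq_eq]
  simp only [Complex.ofReal_sum, Complex.ofReal_pow, Real.norm_eq_abs, sq_abs]

theorem polar_realVec (hE : IsOrthonormalFor q E) (v w : 𝔽) :
    QuadraticMap.polar q (realVec E v) (realVec E w) = ((2 * ⟪v, w⟫_ℝ : ℝ) : ℂ) := by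
  rw [QuadraticMap.polar, ← map_add, apply_realVec hE, apply_realVec hE, apply_realVec hE,
    norm_add_sq_real]
  push_cast
  ring

theorem polarBilin_basis (hE : IsOrthonormalFor q E) (i : Fin n) :
    (-q).polarBilin (E i) = (-2 : ℂ) • E.coord i := by
  refine E.ext fun j => ?_
  rw [QuadraticMap.polarBilin_apply_apply, FunLike.coe_neg, QuadraticMap.polar_neg,
    ← realVec_single E i, ← realVec_single E j, polar_realVec hE, EuclideanSpace.inner_single_left,
    realVec_single]
  obtain rfl | hij := eq_or_ne i j
  · simp
  · simp [hij]

theorem γ_mul_add_swap (hE : IsOrthonormalFor q E) (v w : 𝔽) :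
    γ q E v * γ q E w + γ q E w * γ q E v = -((2 * ⟪v, w⟫_ℝ : ℝ) : ℂ) • (1 : Cl q) := by
  rw [γ_apply, γ_apply, ι_mul_ι_add_swap, FunLike.coe_neg, QuadraticMap.polar_neg, polar_realVec hE,
    Algebra.algebraMap_eq_smul_one]

theorem γ_mul_self (hE : IsOrthonormalFor q E) {u : 𝔽} (hu : ‖u‖ = 1) :
    γ q E u * γ q E u = -1 := by
  rw [γ_apply, ι_sq_scalar, neg_apply, apply_realVec hE, hu]
  simp

theorem γ_mem_pinGroup (hE : IsOrthonormalFor q E) {u : 𝔽} (hu : ‖u‖ = 1) :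
    γ q E u ∈ pinGroup (-q) := by
  have hsq := γ_mul_self hE hu
  have hinv : γ q E u * -γ q E u = 1 := by rw [mul_neg, hsq, neg_neg]
  have hinv' : -γ q E u * γ q E u = 1 := by rw [neg_mul, hsq, neg_neg]
  have hstar : star (γ q E u) = -γ q E u := by rw [γ_apply, star_ι]
  exact pinGroup.mem_iff.2 ⟨⟨⟨γ q E u, -γ q E u, hinv, hinv'⟩,
    Subgroup.subset_closure ⟨realVec E u, rfl⟩, rfl⟩,
    Unitary.mem_iff.2 ⟨by rw [hstar, hinv'], by rw [hstar, hinv]⟩⟩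

theorem γ_hyperplaneReflection_mul (hE : IsOrthonormalFor q E) {u : 𝔽} (hu : ‖u‖ = 1) (v : 𝔽) :
    γ q E ((hyperplaneReflection u).1 v) * γ q E u = involute (γ q E u) * γ q E v := by
  have hswap : γ q E v * γ q E u = -(γ q E u * γ q E v) - ((2 * ⟪u, v⟫_ℝ : ℝ) : ℂ) • 1 := by
    rw [eq_sub_iff_add_eq, eq_neg_iff_add_eq_zero, add_right_comm, add_comm (γ q E v * _),
      γ_mul_add_swap hE, neg_smul, neg_add_cancel]
  rw [hyperplaneReflection_apply hu, map_sub, γ_smul, sub_mul, hswap, smul_mul_assoc,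
    γ_mul_self hE hu, γ_apply u, involute_ι, smul_neg, neg_mul, sub_neg_eq_add, sub_add_cancel]

end RealVectors

variable (q) in
/-- The pin group of the real span of the basis `E`, generated by the unit vectors. An element of
the pin group is encoded as a pair, together with the isometry of `ℝⁿ` it induces. -/
def Pin (E : Module.Basis (Fin n) ℂ V) : Subgroup (Orth n × unitary (Cl q)) :=
  Subgroup.closure {p | ∃ u, ‖u‖ = 1 ∧ p.1 = hyperplaneReflection u ∧ p.2.1 = γ q E u}

variable {E : Module.Basis (Fin n) ℂ V}

/-- The covering of the orthogonal group by the pin group. -/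
def pinProj : Pin q E →* Orth n := (MonoidHom.fst _ _).comp (Pin q E).subtype

theorem continuous_pinProj : Continuous (pinProj : Pin q E →* Orth n) :=
  continuous_fst.comp continuous_subtype_val

theorem mem_pinGroup_of_mem_Pin (hE : IsOrthonormalFor q E) {p : Orth n × unitary (Cl q)}
    (hp : p ∈ Pin q E) : p.2.1 ∈ pinGroup (-q) := by
  induction hp using Subgroup.closure_induction with
  | mem p hp =>
    obtain ⟨u, hu, -, h⟩ := hp
    rw [h]
    exact γ_mem_pinGroup hE hu
  | one => exact one_mem (pinGroup (-q))
  | mul p p' _ _ hp hp' => exact mul_mem hp hp'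
  | inv p _ hp => exact pinGroup.star_mem hp

theorem involute_mul_γ (hE : IsOrthonormalFor q E) {p : Orth n × unitary (Cl q)}
    (hp : p ∈ Pin q E) (v : 𝔽) :
    involute p.2.1 * γ q E v = γ q E (p.1.1 v) * p.2.1 := by
  induction hp using Subgroup.closure_induction generalizing v with
  | mem p hp =>
    obtain ⟨u, hu, h, h'⟩ := hp
    rw [h, h', γ_hyperplaneReflection_mul hE hu]
  | one =>
    change involute (1 : Cl q) * γ q E v = γ q E v * 1
    rw [map_one, one_mul, mul_one]
  | mul p p' _ _ hp hp' =>
    change involute (p.2.1 * p'.2.1) * γ q E v = γ q E (p.1.1 (p'.1.1 v)) * (p.2.1 * p'.2.1)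
    rw [map_mul, mul_assoc, hp' v, ← mul_assoc, hp (p'.1.1 v), mul_assoc]
  | inv p _ hp =>
    have hv : p.1.1 (p⁻¹.1.1 v) = v := congrArg (fun a : Orth n => a.1 v) (mul_inv_cancel p.1)
    have hx : p.2.1 * p⁻¹.2.1 = 1 := congrArg Subtype.val (mul_inv_cancel p.2)
    have hx' : involute p⁻¹.2.1 * involute p.2.1 = 1 := by
      rw [← map_mul, ← map_one involute]
      exact congrArg (involute ·.1) (inv_mul_cancel p.2)
    calc involute p⁻¹.2.1 * γ q E v
        = involute p⁻¹.2.1 * (γ q E (p.1.1 (p⁻¹.1.1 v)) * p.2.1) * p⁻¹.2.1 := by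
          rw [hv, mul_assoc, mul_assoc, hx, mul_one]
      _ = γ q E (p⁻¹.1.1 v) * p⁻¹.2.1 := by rw [← hp, ← mul_assoc, hx', one_mul]

theorem involute_eq_det_smul {p : Orth n × unitary (Cl q)} (hp : p ∈ Pin q E) :
    involute p.2.1 = ((LinearMap.det (p.1.1 : 𝔽 →ₗ[ℝ] 𝔽) : ℝ) : ℂ) • p.2.1 := by
  induction hp using Subgroup.closure_induction with
  | mem p hp =>
    obtain ⟨u, hu, h, h'⟩ := hp
    have hu0 : u ≠ 0 := norm_ne_zero_iff.1 (hu ▸ one_ne_zero)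
    rw [h, h', det_hyperplaneReflection hu0, γ_apply, involute_ι]
    simp
  | one =>
    change involute (1 : Cl q) = ((LinearMap.det (1 : 𝔽 →ₗ[ℝ] 𝔽) : ℝ) : ℂ) • (1 : Cl q)
    simp
  | mul p p' _ _ hp hp' =>
    change involute (p.2.1 * p'.2.1)
      = ((LinearMap.det ((p.1.1 : 𝔽 →ₗ[ℝ] 𝔽) * (p'.1.1 : 𝔽 →ₗ[ℝ] 𝔽)) : ℝ) : ℂ) • (p.2.1 * p'.2.1)
    rw [map_mul, hp, hp', map_mul, Complex.ofReal_mul, smul_mul_smul_comm]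
  | inv p _ hp =>
    have hx : p⁻¹.2.1 * p.2.1 = 1 := congrArg Subtype.val (inv_mul_cancel p.2)
    have hx' : involute p.2.1 * involute p⁻¹.2.1 = 1 := by
      rw [← map_mul, ← map_one involute]
      exact congrArg (involute ·.1) (mul_inv_cancel p.2)
    have hdet : LinearMap.det (p⁻¹.1.1 : 𝔽 →ₗ[ℝ] 𝔽) * LinearMap.det (p.1.1 : 𝔽 →ₗ[ℝ] 𝔽) = 1 := by
      rw [← map_mul, ← map_one (LinearMap.det (A := ℝ) (M := 𝔽))]
      exact congrArg (fun a : Orth n => LinearMap.det (a.1 : 𝔽 →ₗ[ℝ] 𝔽)) (inv_mul_cancel p.1)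
    calc involute p⁻¹.2.1
        = (p⁻¹.2.1 * p.2.1) * involute p⁻¹.2.1 := by rw [hx, one_mul]
      _ = ((LinearMap.det (p⁻¹.1.1 : 𝔽 →ₗ[ℝ] 𝔽) : ℝ) : ℂ) •
          (p⁻¹.2.1 * (involute p.2.1 * involute p⁻¹.2.1)) := by
        rw [hp, smul_mul_assoc, mul_smul_comm, smul_smul, ← Complex.ofReal_mul, hdet,
          Complex.ofReal_one, one_smul, mul_assoc]
      _ = _ := by rw [hx', mul_one]

theorem eq_one_or_eq_neg_one_of_mk_one_mem_Pin (hE : IsOrthonormalFor q E) {x : unitary (Cl q)}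
    (hx : ((1, x) : Orth n × unitary (Cl q)) ∈ Pin q E) : x = 1 ∨ x = -1 := by
  have hcomm (i : Fin n) : involute x.1 * CliffordAlgebra.ι (-q) (E i)
      = CliffordAlgebra.ι (-q) (E i) * x.1 := by
    rw [← realVec_single E i]
    exact involute_mul_γ hE hx (EuclideanSpace.single i 1)
  obtain ⟨c, hc⟩ := mem_range_algebraMap_of_graded_comm E (a := (-2 : ℂ)) (by norm_num)
    (polarBilin_basis hE) hcomm
  have hcc : algebraMap ℂ (Cl q) (c * c) = algebraMap ℂ (Cl q) 1 := by
    have := Unitary.star_mul_self_of_mem x.2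
    rwa [← hc, star_algebraMap, ← map_mul, ← map_one (algebraMap ℂ (Cl q))] at this
  rcases mul_self_eq_one_iff.1 ((algebraMap ℂ (Cl q)).injective hcc) with rfl | rfl
  · exact .inl (Subtype.ext (by simpa using hc.symm))
  · exact .inr (Subtype.ext (by simpa [Unitary.coe_neg] using hc.symm))

theorem mk_γ_mem_Pin (hE : IsOrthonormalFor q E) {u : 𝔽} (hu : ‖u‖ = 1) :
    ((hyperplaneReflection u, ⟨γ q E u, (γ_mem_pinGroup hE hu).2⟩) : Orth n × unitary (Cl q))
      ∈ Pin q E :=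
  Subgroup.subset_closure ⟨u, hu, rfl, rfl⟩

theorem mk_one_neg_one_mem_Pin (hE : IsOrthonormalFor q E) [NeZero n] :
    ((1, -1) : Orth n × unitary (Cl q)) ∈ Pin q E := by
  have hu : ‖(EuclideanSpace.single 0 1 : 𝔽)‖ = 1 := by simp
  convert mul_mem (mk_γ_mem_Pin hE hu) (mk_γ_mem_Pin hE hu) using 1
  exact Prod.ext (hyperplaneReflection_mul_self _).symm (Subtype.ext (γ_mul_self hE hu).symm)

theorem Pin.ext {p p' : Pin q E} (h : pinProj p = pinProj p') (h' : p.1.2 = p'.1.2) : p = p' :=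
  Subtype.ext (Prod.ext h h')

theorem finite_ker_pinProj (hE : IsOrthonormalFor q E) :
    ((pinProj : Pin q E →* Orth n).ker : Set (Pin q E)).Finite := by
  refine Set.Finite.of_finite_image (Set.Finite.subset (Set.toFinite {1, -1}) ?_)
    (f := fun p => p.1.2) fun p hp p' hp' h => Pin.ext ?_ h
  · rintro _ ⟨⟨⟨a, x⟩, hx⟩, rfl : a = 1, rfl⟩
    exact eq_one_or_eq_neg_one_of_mk_one_mem_Pin hE hx
  · exact (MonoidHom.mem_ker.1 hp).trans (MonoidHom.mem_ker.1 hp').symm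

theorem card_ker_pinProj [NeZero n] (hE : IsOrthonormalFor q E) :
    Nat.card (pinProj : Pin q E →* Orth n).ker = 2 := by
  let ε : Pin q E := ⟨_, mk_one_neg_one_mem_Pin hE⟩
  refine Nat.card_eq_two_iff.2 ⟨1, ⟨ε, rfl⟩, fun h => ?_, ?_⟩
  · have hx : (1 : Cl q) = -1 := congrArg (fun p => p.1.1.2.1) h
    rw [← map_one (algebraMap ℂ (Cl q)), ← map_neg] at hx
    exact absurd ((algebraMap ℂ (Cl q)).injective hx) (by norm_num)
  · refine Set.eq_univ_of_forall ?_
    rintro ⟨⟨⟨a, x⟩, hx⟩, rfl : a = 1⟩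
    exact (eq_one_or_eq_neg_one_of_mk_one_mem_Pin hE hx).imp
      (fun h => Subtype.ext (Pin.ext rfl h)) (fun h => Subtype.ext (Pin.ext rfl h))

section Covering

/-- The pin elements `1` and `u`, for `u` a unit vector. -/
def pinVectors (q : QuadraticForm ℂ V) (E : Module.Basis (Fin n) ℂ V) : Set (Pin q E) :=
  {1} ∪ {p | ∃ u, ‖u‖ = 1 ∧ p.1.1 = hyperplaneReflection u ∧ p.1.2.1 = γ q E u}

theorem isCompact_pinVectors (hE : IsOrthonormalFor q E) [FiniteDimensional ℂ V] :
    IsCompact (pinVectors q E) := by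
  let s : Metric.sphere (0 : 𝔽) 1 → Pin q E := fun u =>
    ⟨_, mk_γ_mem_Pin hE (norm_eq_of_mem_sphere u)⟩
  have hs : Continuous s :=
    (continuous_hyperplaneReflection.prodMk
      ((continuous_γ.comp continuous_subtype_val).subtype_mk _)).subtype_mk _
  have himage : {p : Pin q E | ∃ u, ‖u‖ = 1 ∧ p.1.1 = hyperplaneReflection u ∧ p.1.2.1 = γ q E u}
      = Set.range s := by
    ext p
    refine ⟨fun ⟨u, hu, h, h'⟩ => ⟨⟨u, by simpa using hu⟩, ?_⟩, ?_⟩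
    · exact Subtype.ext (Prod.ext h.symm (Subtype.ext h'.symm))
    · rintro ⟨u, rfl⟩
      exact ⟨u, norm_eq_of_mem_sphere u, rfl, rfl⟩
  exact isCompact_singleton.union (himage ▸ isCompact_range hs)

theorem isCompact_pinVectors_pow (hE : IsOrthonormalFor q E) [FiniteDimensional ℂ V] (k : ℕ) :
    IsCompact (pinVectors q E ^ k) := by
  induction k with
  | zero => exact pow_zero (pinVectors q E) ▸ isCompact_singleton
  | succ k ih => exact pow_succ (pinVectors q E) k ▸ ih.mul (isCompact_pinVectors hE)

theorem exists_mem_pinVectors (hE : IsOrthonormalFor q E) (u : 𝔽) :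
    ∃ p ∈ pinVectors q E, pinProj p = hyperplaneReflection u := by
  obtain rfl | hu := eq_or_ne u 0
  · exact ⟨1, .inl rfl, by rw [map_one, hyperplaneReflection_zero]⟩
  · have hu1 := norm_smul_inv_norm (𝕜 := ℝ) hu
    refine ⟨⟨_, mk_γ_mem_Pin hE hu1⟩, .inr ⟨_, hu1, rfl, rfl⟩, ?_⟩
    exact hyperplaneReflection_smul (by simpa using hu) u

theorem exists_mem_pinVectors_pow (hE : IsOrthonormalFor q E) (a : Orth n) :
    ∃ p ∈ pinVectors q E ^ n, pinProj p = a := by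
  obtain ⟨l, hl, rfl⟩ := exists_prod_hyperplaneReflection a
  suffices ∃ p ∈ pinVectors q E ^ l.length, pinProj p = (l.map hyperplaneReflection).prod by
    obtain ⟨p, hp, h⟩ := this
    exact ⟨p, Set.pow_subset_pow_right (.inl rfl) hl hp, h⟩
  clear hl
  induction l with
  | nil => exact ⟨1, by simp, map_one _⟩
  | cons u l ih =>
    obtain ⟨p, hp, hpu⟩ := exists_mem_pinVectors hE u
    obtain ⟨p', hp', hpl⟩ := ih
    refine ⟨p * p', ?_, ?_⟩
    · rw [List.length_cons, pow_succ']
      exact Set.mul_mem_mul hp hp'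
    · exact (pinProj.map_mul p p').trans (congrArg₂ (· * ·) hpu hpl)

theorem surjective_pinProj (hE : IsOrthonormalFor q E) :
    Function.Surjective (pinProj : Pin q E → Orth n) := fun a =>
  let ⟨p, _, hp⟩ := exists_mem_pinVectors_pow hE a
  ⟨p, hp⟩

theorem isCoveringMap_pinProj (hE : IsOrthonormalFor q E) [FiniteDimensional ℂ V] :
    IsCoveringMap (pinProj : Pin q E → Orth n) := by
  have hcompact : CompactSpace (pinVectors q E ^ n : Set (Pin q E)) :=
    isCompact_iff_compactSpace.1 (isCompact_pinVectors_pow hE n)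
  have hquotient : IsQuotientMap (pinProj : Pin q E → Orth n) := by
    refine .of_comp continuous_subtype_val continuous_pinProj
      (f := (Subtype.val : (pinVectors q E ^ n : Set (Pin q E)) → Pin q E)) ?_
    refine IsQuotientMap.of_surjective_continuous (fun a => ?_)
      (continuous_pinProj.comp continuous_subtype_val)
    obtain ⟨p, hp, h⟩ := exists_mem_pinVectors_pow hE a
    exact ⟨⟨p, hp⟩, h⟩
  exact (hquotient.isQuotientCoveringMap_of_isDiscrete_ker_monoidHom
    (finite_ker_pinProj hE).isDiscrete).isCoveringMap

end Covering

end Pin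

section TwistedExtension

open scoped unitInterval

variable {M O E : Type*} [TopologicalSpace M] [Monoid M] [TopologicalSpace O]

/-- The condition on a self-map `f` of `M` to preserve the fibres of `r` and the submonoid `N`,
imposed on the stages of a homotopy. -/
def IsFibrewise (r : C(M, O)) (N : Submonoid M) (f : C(M, M)) : Prop :=
  (∀ m, r (f m) = r m) ∧ Set.MapsTo f N N

section Homotopy

variable {r : C(M, O)} {N : Submonoid M} {f₀ : C(M, M)}

theorem map_homotopy (H : f₀.HomotopyWith (.id M) (IsFibrewise r N)) (t : I) (m : M) :
    r (H (t, m)) = r m :=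
  (H.prop' t).1 m

theorem homotopy_mem (H : f₀.HomotopyWith (.id M) (IsFibrewise r N)) (t : I) {m : M}
    (hm : m ∈ N) : H (t, m) ∈ N :=
  (H.prop' t).2 hm

end Homotopy

variable [Group O] [TopologicalSpace E] [Group E]

/-- `c` lifts the failure of `r : M → O` to be multiplicative along `π : E → O`, trivially over the
submonoid `N`. Such a `c` is the factor set of the extension constructed below. -/
structure IsDefectLift (π : E →* O) (r : C(M, O)) (N : Submonoid M) (c : C(M × M, E)) : Prop where
  map_eq : ∀ a b, π (c (a, b)) = r (a * b) * (r a * r b)⁻¹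
  eq_one : ∀ a ∈ N, ∀ b ∈ N, c (a, b) = 1

variable {π : E →* O} {r : C(M, O)} {N : Submonoid M} {f₀ : C(M, M)} {c : C(M × M, E)}

theorem map_one_of_map_mul (hr : ∀ a ∈ N, ∀ b ∈ N, r (a * b) = r a * r b) : r 1 = 1 := by
  simpa using hr 1 N.one_mem 1 N.one_mem

theorem exists_isDefectLift [ContinuousMul M] [IsTopologicalGroup O] (hπ : IsCoveringMap π)
    (hr : ∀ a ∈ N, ∀ b ∈ N, r (a * b) = r a * r b)
    (H : f₀.HomotopyWith (.id M) (IsFibrewise r N)) (h₀ : ∀ m, f₀ m ∈ N) :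
    ∃ c, IsDefectLift π r N c := by
  let D : C(I × (M × M), O) :=
    ⟨fun p => r (H (p.1, p.2.1) * H (p.1, p.2.2)) * (r p.2.1 * r p.2.2)⁻¹, by fun_prop⟩
  have hD_one (t) {a b} (ha : H (t, a) ∈ N) (hb : H (t, b) ∈ N) : D (t, a, b) = 1 := by
    change r (H (t, a) * H (t, b)) * (r a * r b)⁻¹ = 1
    rw [hr _ ha _ hb, map_homotopy, map_homotopy, mul_inv_cancel]
  have hD_zero (m) : D (0, m) = π ((1 : C(M × M, E)) m) := by
    rw [ContinuousMap.one_apply, map_one]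
    exact hD_one 0 (by simpa using h₀ m.1) (by simpa using h₀ m.2)
  let L := hπ.liftHomotopy D 1 hD_zero
  have hL (p) : π (L p) = D p := congr_fun (hπ.liftHomotopy_lifts D 1 hD_zero) p
  refine ⟨L.comp ⟨fun m => (1, m), by fun_prop⟩, fun a b => ?_, fun a ha b hb => ?_⟩
  · refine (hL (1, a, b)).trans ?_
    change r (H (1, a) * H (1, b)) * (r a * r b)⁻¹ = _
    rw [H.apply_one, H.apply_one, ContinuousMap.id_apply, ContinuousMap.id_apply]
  · have hconst : L (1, a, b) = L (0, a, b) :=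
      hπ.const_of_comp (g := fun t : I => L (t, a, b)) (by fun_prop)
        (fun t t' => by
          rw [hL, hL, hD_one t (homotopy_mem H t ha) (homotopy_mem H t hb),
            hD_one t' (homotopy_mem H t' ha) (homotopy_mem H t' hb)]) 1 0
    exact hconst.trans (hπ.liftHomotopy_zero D 1 hD_zero (a, b))

namespace IsDefectLift

theorem apply_mul (hc : IsDefectLift π r N c) {a b : M} {x y : E} (hx : r a = π x)
    (hy : r b = π y) : r (a * b) = π (c (a, b) * x * y) := by
  rw [map_mul π, map_mul π, hc.map_eq, ← hx, ← hy]
  group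

theorem one_left (hc : IsDefectLift π r N c) (hπ : IsCoveringMap π)
    (hr : ∀ a ∈ N, ∀ b ∈ N, r (a * b) = r a * r b)
    (H : f₀.HomotopyWith (.id M) (IsFibrewise r N)) (h₀ : ∀ m, f₀ m ∈ N) (m : M) :
    c (1, m) = 1 := by
  have h := hπ.eq_of_comp_eq (g₁ := fun t => c (1, H (t, m))) (g₂ := fun _ => 1)
    (by fun_prop) continuous_const
    (funext fun t => by simp [hc.map_eq, map_one_of_map_mul hr]) 0
    (hc.eq_one _ N.one_mem _ (by simpa using h₀ m))
  simpa using congr_fun h 1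

theorem assoc [ContinuousMul M] [ContinuousMul E] (hc : IsDefectLift π r N c)
    (hπ : IsCoveringMap π) (H : f₀.HomotopyWith (.id M) (IsFibrewise r N)) (h₀ : ∀ m, f₀ m ∈ N)
    {a : M} {x : E} (hx : r a = π x) (b e : M) :
    c (a * b, e) * c (a, b) * x = c (a, b * e) * x * c (b, e) := by
  have hx' (t) : π x = r (H (t, a)) := by rw [map_homotopy, hx]
  have h₀' (m) : H (0, m) ∈ N := by simpa using h₀ m
  have h := hπ.eq_of_comp_eq
    (g₁ := fun t => c (H (t, a) * H (t, b), H (t, e)) * c (H (t, a), H (t, b)) * x)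
    (g₂ := fun t => c (H (t, a), H (t, b) * H (t, e)) * x * c (H (t, b), H (t, e)))
    (by fun_prop) (by fun_prop)
    (funext fun t => by
      simp only [Function.comp_apply, map_mul, hc.map_eq, hx' t, mul_assoc (H (t, a))]
      group) 0
    (by
      simp only [hc.eq_one _ (N.mul_mem (h₀' a) (h₀' b)) _ (h₀' e), hc.eq_one _ (h₀' a) _ (h₀' b),
        hc.eq_one _ (h₀' a) _ (N.mul_mem (h₀' b) (h₀' e)), hc.eq_one _ (h₀' b) _ (h₀' e), one_mul,
        mul_one])
  simpa using congr_fun h 1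

end IsDefectLift

/-- The group law `(g, x) (h, y) = (g h, c(ρ g, ρ h) x y)` on the pullback. -/
@[reducible]
def IsDefectLift.group {G : Type*} [Group G] [ContinuousMul M] [ContinuousMul E]
    (hc : IsDefectLift π r N c) (hπ : IsCoveringMap π)
    (hr : ∀ a ∈ N, ∀ b ∈ N, r (a * b) = r a * r b)
    (H : f₀.HomotopyWith (.id M) (IsFibrewise r N)) (h₀ : ∀ m, f₀ m ∈ N) (ρ : G →* M) :
    Group (Function.Pullback (r ∘ ρ) π) :=
  have hp (p : Function.Pullback (r ∘ ρ) π) : r (ρ p.fst) = π p.snd := p.2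
  letI : Mul (Function.Pullback (r ∘ ρ) π) :=
    ⟨fun p p' => ⟨(p.fst * p'.fst, c (ρ p.fst, ρ p'.fst) * p.snd * p'.snd),
      (congrArg r (map_mul ρ _ _)).trans (hc.apply_mul (hp p) (hp p'))⟩⟩
  letI : One (Function.Pullback (r ∘ ρ) π) := ⟨⟨(1, 1), by simp [map_one_of_map_mul hr]⟩⟩
  letI : Inv (Function.Pullback (r ∘ ρ) π) :=
    ⟨fun p => ⟨(p.fst⁻¹, (c (ρ p.fst⁻¹, ρ p.fst))⁻¹ * p.snd⁻¹), by
      simp [hc.map_eq, hp p, ← map_mul ρ, map_one_of_map_mul hr]⟩⟩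
  Group.ofLeftAxioms
    (fun p₁ p₂ p₃ => Subtype.ext <| Prod.ext (mul_assoc _ _ _) <| by
      change c (ρ (p₁.fst * p₂.fst), ρ p₃.fst) * (c (ρ p₁.fst, ρ p₂.fst) * p₁.snd * p₂.snd) * p₃.snd
        = c (ρ p₁.fst, ρ (p₂.fst * p₃.fst)) * p₁.snd * (c (ρ p₂.fst, ρ p₃.fst) * p₂.snd * p₃.snd)
      rw [map_mul, map_mul, ← mul_assoc, ← mul_assoc, ← mul_assoc, ← mul_assoc,
        hc.assoc hπ H h₀ (hp p₁)])
    (fun p => Subtype.ext <| Prod.ext (one_mul _) <| by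
      change c (ρ 1, ρ p.fst) * 1 * p.snd = p.snd
      rw [map_one, hc.one_left hπ hr H h₀, one_mul, one_mul])
    (fun p => Subtype.ext <| Prod.ext (inv_mul_cancel _) <| by
      change c (ρ p.fst⁻¹, ρ p.fst) * ((c (ρ p.fst⁻¹, ρ p.fst))⁻¹ * p.snd⁻¹) * p.snd = 1
      group)

theorem exists_twistedExtension {G : Type*} [TopologicalSpace G] [Group G] [IsTopologicalGroup G]
    [ContinuousMul M] [IsTopologicalGroup O] [IsTopologicalGroup E] (hπ : IsCoveringMap π)
    (hr : ∀ a ∈ N, ∀ b ∈ N, r (a * b) = r a * r b)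
    (H : f₀.HomotopyWith (.id M) (IsFibrewise r N)) (h₀ : ∀ m, f₀ m ∈ N)
    {ρ : G →* M} (hρ : Continuous ρ) :
    ∃ (_ : Group (Function.Pullback (r ∘ ρ) π))
      (_ : IsTopologicalGroup (Function.Pullback (r ∘ ρ) π)),
      (∀ p p' : Function.Pullback (r ∘ ρ) π, (p * p').fst = p.fst * p'.fst) ∧
      ∀ p p' : Function.Pullback (r ∘ ρ) π, ρ p.fst ∈ N → ρ p'.fst ∈ N →
        (p * p').snd = p.snd * p'.snd := by
  obtain ⟨c, hc⟩ := exists_isDefectLift hπ hr H h₀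
  let _ := hc.group hπ hr H h₀ ρ
  have hfst : Continuous fun p : Function.Pullback (r ∘ ρ) π => p.fst :=
    continuous_fst.comp continuous_subtype_val
  have hsnd : Continuous fun p : Function.Pullback (r ∘ ρ) π => p.snd :=
    continuous_snd.comp continuous_subtype_val
  have hmul : ContinuousMul (Function.Pullback (r ∘ ρ) π) := ⟨by
    have : Continuous fun p : Function.Pullback (r ∘ ρ) π × Function.Pullback (r ∘ ρ) π =>
        (p.1.fst * p.2.fst, c (ρ p.1.fst, ρ p.2.fst) * p.1.snd * p.2.snd) := by fun_prop
    exact this.subtype_mk _⟩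
  have hinv : ContinuousInv (Function.Pullback (r ∘ ρ) π) := ⟨by
    have : Continuous fun p : Function.Pullback (r ∘ ρ) π =>
        (p.fst⁻¹, (c (ρ p.fst⁻¹, ρ p.fst))⁻¹ * p.snd⁻¹) := by fun_prop
    exact this.subtype_mk _⟩
  refine ⟨inferInstance, ⟨⟩, fun _ _ => rfl, fun p p' hp hp' => ?_⟩
  change c (ρ p.fst, ρ p'.fst) * p.snd * p'.snd = _
  rw [hc.eq_one _ hp _ hp', one_mul]

end TwistedExtension

section Pullback

theorem isEvenlyCovered_pullback_fst {X B E I : Type*} [TopologicalSpace X] [TopologicalSpace B]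
    [TopologicalSpace E] [TopologicalSpace I] {f : X → B} {π : E → B}
    (hf : Continuous f) {x : X} (h : IsEvenlyCovered π (f x) I) :
    IsEvenlyCovered (Function.Pullback.fst : f.Pullback π → X) x I := by
  obtain ⟨hI, U, hxU, hU, -, H, hH⟩ := h
  have hfst : Continuous (Function.Pullback.fst : f.Pullback π → X) :=
    continuous_fst.comp continuous_subtype_val
  have hπU (p : f.Pullback π) (hp : p.fst ∈ f ⁻¹' U) : p.snd ∈ π ⁻¹' U := by
    rwa [Set.mem_preimage, ← show f p.fst = π p.snd from p.2]
  have hHs (v : U × I) : π (H.symm v) = v.1 := by rw [← hH, H.apply_symm_apply]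
  refine ⟨hI, f ⁻¹' U, hxU, hU.preimage hf, (hU.preimage hf).preimage hfst,
    { toFun := fun p => (⟨p.1.fst, p.2⟩, (H ⟨p.1.snd, hπU p.1 p.2⟩).2)
      invFun := fun z => ⟨⟨(z.1.1, (H.symm (⟨f z.1.1, z.1.2⟩, z.2)).1),
        (hHs (⟨f z.1.1, z.1.2⟩, z.2)).symm⟩, z.1.2⟩
      left_inv := fun p => Subtype.ext <| Subtype.ext <| Prod.ext rfl ?_
      right_inv := fun z => Prod.ext rfl ?_
      continuous_toFun := ?_
      continuous_invFun := ?_ }, fun _ => rfl⟩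
  · have hp : (⟨f p.1.fst, p.2⟩, (H ⟨p.1.snd, hπU p.1 p.2⟩).2) = H ⟨p.1.snd, hπU p.1 p.2⟩ :=
      Prod.ext (Subtype.ext (Eq.trans p.1.2 (hH ⟨p.1.snd, _⟩).symm)) rfl
    change (H.symm (⟨f p.1.fst, p.2⟩, _)).1 = p.1.snd
    rw [hp, H.symm_apply_apply]
  · have hz := congrArg Prod.snd (H.apply_symm_apply (⟨f z.1.1, z.1.2⟩, z.2))
    exact hz
  · have hsnd : Continuous (Function.Pullback.snd : f.Pullback π → E) :=
      continuous_snd.comp continuous_subtype_val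
    fun_prop
  · fun_prop

theorem isCoveringMap_pullback_fst {X B E : Type*} [TopologicalSpace X] [TopologicalSpace B]
    [TopologicalSpace E] {f : X → B} {π : E → B} (hπ : IsCoveringMap π) (hf : Continuous f) :
    IsCoveringMap (Function.Pullback.fst : f.Pullback π → X) :=
  fun x => (isEvenlyCovered_pullback_fst hf (hπ (f x))).to_isEvenlyCovered_preimage

theorem surjective_pullback_fst {X B E : Type*} {f : X → B} {π : E → B}
    (hπ : Function.Surjective π) : Function.Surjective (Function.Pullback.fst : f.Pullback π → X) :=
  fun x => (hπ (f x)).elim fun y hy => ⟨⟨(x, y), hy.symm⟩, rfl⟩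

/-- The fibre of a pullback over `x` is the fibre over `f x`. -/
def pullbackFiberEquiv {X B E : Type*} (f : X → B) (π : E → B) (x : X) :
    {p : f.Pullback π // p.fst = x} ≃ {y // π y = f x} where
  toFun p := ⟨p.1.snd, p.1.2.symm.trans (congrArg f p.2)⟩
  invFun y := ⟨⟨(x, y.1), y.2.symm⟩, rfl⟩
  left_inv := fun ⟨p, hp⟩ => by subst hp; rfl
  right_inv _ := rfl

end Pullback

theorem normal_le_center_of_card_eq_two {G : Type*} [Group G] {N : Subgroup G} [hN : N.Normal]
    (h : Nat.card N = 2) : N ≤ Subgroup.center G := by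
  intro z hz
  refine Subgroup.mem_center_iff.2 fun g => ?_
  rcases eq_or_ne z 1 with rfl | hz1
  · simp
  obtain ⟨w, -, hw⟩ := Nat.card_eq_two_iff' (1 : N) |>.1 h
  have hzw : (⟨z, hz⟩ : N) = w := hw _ fun h => hz1 (congrArg Subtype.val h)
  have hgw : (⟨g * z * g⁻¹, hN.conj_mem z hz g⟩ : N) = w := hw _ fun h => hz1 <| by
    simpa using congrArg Subtype.val h
  have hconj : g * z * g⁻¹ = z := congrArg Subtype.val (hgw.trans hzw.symm)
  exact mul_inv_eq_iff_eq_mul.1 hconj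

section LocalHomeomorph

section

variable {X Y : Type*} [TopologicalSpace X] [TopologicalSpace Y] {p : X → Y}

/-- A choice of an open partial homeomorphism around `x` that agrees with `p`. -/
def localHomeo (hp : IsLocalHomeomorph p) (x : X) : OpenPartialHomeomorph X Y :=
  (hp x).choose

theorem mem_localHomeo_source (hp : IsLocalHomeomorph p) (x : X) : x ∈ (localHomeo hp x).source :=
  (hp x).choose_spec.1

theorem coe_localHomeo (hp : IsLocalHomeomorph p) (x : X) : ⇑(localHomeo hp x) = p :=
  (hp x).choose_spec.2.symm

theorem apply_localHomeo_symm (hp : IsLocalHomeomorph p) (x : X) {y : Y}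
    (hy : y ∈ (localHomeo hp x).target) :
    p ((localHomeo hp x).symm y) = y := by
  simpa only [coe_localHomeo] using (localHomeo hp x).right_inv hy

end

variable {H M M' : Type*} [TopologicalSpace H] [TopologicalSpace M] [ChartedSpace H M]
  [TopologicalSpace M'] {p : M' → M}

/-- The charted space structure on the source of a local homeomorphism `p`, with the charts
`chartAt H (p x) ∘ p`. -/
@[reducible]
def pullbackChartedSpace (hp : IsLocalHomeomorph p) : ChartedSpace H M' where
  atlas := Set.range fun x => (localHomeo hp x).trans (chartAt H (p x))
  chartAt x := (localHomeo hp x).trans (chartAt H (p x))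
  mem_chart_source x := by
    rw [OpenPartialHomeomorph.trans_source, Set.mem_inter_iff, Set.mem_preimage, coe_localHomeo]
    exact ⟨mem_localHomeo_source hp x, mem_chart_source H (p x)⟩
  chart_mem_atlas x := ⟨x, rfl⟩

theorem pullback_transition_eqOn (hp : IsLocalHomeomorph p) (x y : M') :
    let e := (localHomeo hp x).trans (chartAt H (p x))
    let e' := (localHomeo hp y).trans (chartAt H (p y))
    let t := (chartAt H (p x)).symm.trans (chartAt H (p y))
    ∀ z ∈ (e.symm.trans e').source, z ∈ t.source ∧ (e.symm.trans e') z = t z := by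
  intro e e' t z hz
  simp only [e, e', t, OpenPartialHomeomorph.trans_source, OpenPartialHomeomorph.symm_source,
    OpenPartialHomeomorph.trans_symm_eq_symm_trans_symm, OpenPartialHomeomorph.coe_trans,
    Set.mem_inter_iff, Set.mem_preimage, Function.comp_apply, coe_localHomeo] at hz ⊢
  obtain ⟨⟨hzx, hzl⟩, -, hzy⟩ := hz
  rw [apply_localHomeo_symm hp x hzl] at hzy ⊢
  exact ⟨⟨hzx, hzy⟩, rfl⟩

variable {𝕜 F : Type*} [NontriviallyNormedField 𝕜] [NormedAddCommGroup F] [NormedSpace 𝕜 F]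
  {I : ModelWithCorners 𝕜 F H}

theorem pullback_isManifold (hp : IsLocalHomeomorph p) (n : WithTop ℕ∞) [IsManifold I n M] :
    letI := pullbackChartedSpace (H := H) hp
    IsManifold I n M' := by
  let := pullbackChartedSpace (H := H) hp
  have hgroupoid : HasGroupoid M' (contDiffGroupoid n I) := by
    refine ⟨?_⟩
    rintro _ _ ⟨x, rfl⟩ ⟨y, rfl⟩
    have htransition := HasGroupoid.compatible (G := contDiffGroupoid n I)
      (chart_mem_atlas H (p x)) (chart_mem_atlas H (p y))
    have hopen := (((localHomeo hp x).trans (chartAt H (p x))).symm.trans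
      ((localHomeo hp y).trans (chartAt H (p y)))).open_source
    have heq := pullback_transition_eqOn (H := H) hp x y
    refine (contDiffGroupoid n I).mem_of_eqOnSource (closedUnderRestriction' htransition hopen)
      ⟨?_, fun z hz => (heq z hz).2⟩
    rw [OpenPartialHomeomorph.restr_source, hopen.interior_eq]
    exact (Set.inter_eq_right.2 fun z hz => (heq z hz).1).symm
  exact { hgroupoid with }

theorem contMDiffAt_pullback_iff {F' H' N : Type*} [NormedAddCommGroup F'] [NormedSpace 𝕜 F']
    [TopologicalSpace H'] {J : ModelWithCorners 𝕜 F' H'} [TopologicalSpace N] [ChartedSpace H' N]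
    (hp : IsLocalHomeomorph p) {n : WithTop ℕ∞} {f : N → M'} {y : N} :
    letI := pullbackChartedSpace (H := H) hp
    ContMDiffAt J I n f y ↔ ContinuousAt f y ∧ ContMDiffAt J I n (p ∘ f) y := by
  let := pullbackChartedSpace (H := H) hp
  have hchart : extChartAt I (f y) ∘ f = extChartAt I (p (f y)) ∘ p ∘ f := by
    funext z
    change I (chartAt H (p (f y)) (localHomeo hp (f y) (f z))) = _
    rw [coe_localHomeo]
    rfl
  rw [contMDiffAt_iff_target, contMDiffAt_iff_target (f := p ∘ f), hchart]
  exact ⟨fun h => ⟨h.1, hp.continuous.continuousAt.comp h.1, h.2⟩, fun h => ⟨h.1, h.2.2⟩⟩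

theorem contMDiff_pullback_iff {F' H' N : Type*} [NormedAddCommGroup F'] [NormedSpace 𝕜 F']
    [TopologicalSpace H'] {J : ModelWithCorners 𝕜 F' H'} [TopologicalSpace N] [ChartedSpace H' N]
    (hp : IsLocalHomeomorph p) {n : WithTop ℕ∞} {f : N → M'} :
    letI := pullbackChartedSpace (H := H) hp
    ContMDiff J I n f ↔ Continuous f ∧ ContMDiff J I n (p ∘ f) := by
  simp only [ContMDiff, contMDiffAt_pullback_iff hp, forall_and, continuous_iff_continuousAt]

theorem contMDiff_pullback_map (hp : IsLocalHomeomorph p) (n : WithTop ℕ∞) :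
    letI := pullbackChartedSpace (H := H) hp
    ContMDiff I I n p :=
  let _ := pullbackChartedSpace (H := H) hp
  ((contMDiff_pullback_iff hp).1 contMDiff_id).2

theorem pullback_isLocalDiffeomorph (hp : IsLocalHomeomorph p) (n : WithTop ℕ∞) :
    letI := pullbackChartedSpace (H := H) hp
    IsLocalDiffeomorph I I n p := by
  let := pullbackChartedSpace (H := H) hp
  intro x
  refine ⟨{ (localHomeo hp x).toPartialEquiv with
    open_source := (localHomeo hp x).open_source
    open_target := (localHomeo hp x).open_target
    contMDiffOn_toFun := ?_
    contMDiffOn_invFun := fun y hy => ContMDiffAt.contMDiffWithinAt ?_ },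
    mem_localHomeo_source hp x, fun z _ => (congrFun (coe_localHomeo hp x) z).symm⟩
  · change ContMDiffOn I I n (localHomeo hp x) _
    rw [coe_localHomeo]
    exact (contMDiff_pullback_map hp n).contMDiffOn
  · refine (contMDiffAt_pullback_iff hp).2 ⟨(localHomeo hp x).continuousAt_symm hy, ?_⟩
    refine contMDiffAt_id.congr_of_eventuallyEq ?_
    filter_upwards [(localHomeo hp x).open_target.mem_nhds hy] with w hw
    exact apply_localHomeo_symm hp x hw

theorem pullback_lieGroup {G G' : Type*} [TopologicalSpace G] [Group G] [ChartedSpace H G]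
    {n : WithTop ℕ∞} [LieGroup I n G] [TopologicalSpace G'] [Group G'] [IsTopologicalGroup G']
    (β : G' →* G) (hβ : IsLocalHomeomorph β) :
    letI := pullbackChartedSpace (H := H) hβ
    LieGroup I n G' := by
  let := pullbackChartedSpace (H := H) hβ
  have := pullback_isManifold (I := I) hβ n
  have hβ' : ContMDiff I I n β := contMDiff_pullback_map hβ n
  refine { contMDiff_mul := (contMDiff_pullback_iff hβ).2 ⟨continuous_mul, ?_⟩,
           contMDiff_inv := (contMDiff_pullback_iff hβ).2 ⟨continuous_inv, ?_⟩ }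
  · exact ((hβ'.comp contMDiff_fst).mul (hβ'.comp contMDiff_snd)).congr fun z => map_mul β _ _
  · exact hβ'.inv.congr fun z => map_inv β z

end LocalHomeomorph

section GramSchmidt

open InnerProductSpace Submodule Set
open scoped InnerProductSpace

variable {𝕜 ι H : Type*} [RCLike 𝕜] [LinearOrder ι] [LocallyFiniteOrderBot ι] [WellFoundedLT ι]
  [NormedAddCommGroup H] [InnerProductSpace 𝕜 H]

theorem gramSchmidt_sub_mem_span (f : ι → H) (i : ι) :
    gramSchmidt 𝕜 f i - f i ∈ span 𝕜 (f '' Iio i) := by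
  rw [gramSchmidt_def, sub_sub_cancel_left, ← span_gramSchmidt_Iio 𝕜 f i]
  refine neg_mem (sum_mem fun j hj => ?_)
  have hj' : gramSchmidt 𝕜 f j ∈ gramSchmidt 𝕜 f '' Iio i := ⟨j, Finset.mem_Iio.1 hj, rfl⟩
  exact span_mono (singleton_subset_iff.2 hj') (starProjection_apply_mem _ _)

theorem gramSchmidt_eq_smul {f g : ι → H} {c : ι → 𝕜} (hc : ∀ i, c i ≠ 0)
    (h : ∀ i, g i - c i • gramSchmidt 𝕜 f i ∈ span 𝕜 (f '' Iio i)) (i : ι) :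
    gramSchmidt 𝕜 g i = c i • gramSchmidt 𝕜 f i := by
  induction i using WellFoundedLT.induction with
  | ind i ih =>
    have hspan : span 𝕜 (g '' Iio i) ≤ span 𝕜 (f '' Iio i) := by
      rw [← span_gramSchmidt_Iio 𝕜 g, ← span_gramSchmidt_Iio 𝕜 f, span_le]
      rintro _ ⟨j, hj, rfl⟩
      rw [ih j hj]
      exact smul_mem _ _ (subset_span ⟨j, hj, rfl⟩)
    have hmem : gramSchmidt 𝕜 g i - c i • gramSchmidt 𝕜 f i ∈
        span 𝕜 (gramSchmidt 𝕜 f '' Iio i) := by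
      rw [span_gramSchmidt_Iio]
      simpa using add_mem (hspan (gramSchmidt_sub_mem_span g i)) (h i)
    have horth : span 𝕜 (gramSchmidt 𝕜 f '' Iio i) ≤
        (𝕜 ∙ (gramSchmidt 𝕜 g i - c i • gramSchmidt 𝕜 f i))ᗮ := by
      rw [span_le]
      rintro _ ⟨j, hj, rfl⟩
      rw [SetLike.mem_coe, mem_orthogonal_singleton_iff_inner_left]
      have hg := gramSchmidt_orthogonal 𝕜 g (ne_of_lt hj)
      rw [ih j hj, inner_smul_left, mul_eq_zero, or_iff_right (by simpa using hc j)] at hg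
      rw [inner_sub_right, hg, inner_smul_right, gramSchmidt_orthogonal 𝕜 f (ne_of_lt hj), mul_zero,
        sub_zero]
    exact sub_eq_zero.1
      (inner_self_eq_zero.1 (mem_orthogonal_singleton_iff_inner_left.1 (horth hmem)))

theorem linearIndependent_of_gramSchmidt_ne_zero [Finite ι] {f : ι → H}
    (hf : ∀ i, gramSchmidt 𝕜 f i ≠ 0) : LinearIndependent 𝕜 f := by
  have := Fintype.ofFinite ι
  have h := linearIndependent_of_ne_zero_of_inner_eq_zero hf (gramSchmidt_pairwise_orthogonal 𝕜 f)
  rw [linearIndependent_iff_card_eq_finrank_span] at h ⊢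
  rw [h, Set.finrank, span_gramSchmidt, Set.finrank]

theorem continuousAt_gramSchmidt {X : Type*} [TopologicalSpace X] {f : X → ι → H} {x : X}
    (hf : ∀ i, ContinuousAt (fun y => f y i) x) (hx : LinearIndependent 𝕜 (f x)) (i : ι) :
    ContinuousAt (fun y => gramSchmidt 𝕜 (f y) i) x := by
  induction i using WellFoundedLT.induction with
  | ind i ih =>
    simp only [gramSchmidt_def _ _ i, starProjection_singleton]
    refine (hf i).sub (tendsto_finsetSum _ fun j hj => ?_)
    have hcont := ih j (Finset.mem_Iio.1 hj)
    have hnorm : ((‖gramSchmidt 𝕜 (f x) j‖ ^ 2 : ℝ) : 𝕜) ≠ 0 := by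
      simpa using gramSchmidt_ne_zero j hx
    exact ((hcont.inner (hf i)).div
      (RCLike.continuous_ofReal.continuousAt.comp (hcont.norm.pow 2)) hnorm).smul hcont

end GramSchmidt

section OrthogonalPart

open InnerProductSpace Set
open scoped InnerProductSpace

variable {n : ℕ}
local notation "𝔽" => EuclideanSpace ℝ (Fin n)

/-- The columns of the matrix of an operator. -/
def columns (a : EuclideanSpace ℝ (Fin n) →L[ℝ] EuclideanSpace ℝ (Fin n)) :
    Fin n → EuclideanSpace ℝ (Fin n) :=
  a ∘ EuclideanSpace.basisFun (Fin n) ℝ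

theorem linearIndependent_columns {a : 𝔽 →L[ℝ] 𝔽} :
    LinearIndependent ℝ (columns a) ↔ Function.Injective a := by
  have hb := (EuclideanSpace.basisFun (Fin n) ℝ).toBasis.linearIndependent
  refine ⟨fun h => ?_, fun h => ?_⟩
  · exact LinearMap.injective_of_linearIndependent
      (EuclideanSpace.basisFun (Fin n) ℝ).toBasis.span_eq h
  · exact hb.map' a.toLinearMap (LinearMap.ker_eq_bot.2 h)

/-- The orthogonal factor in the QR decomposition of an invertible operator. -/
def orthPart (a : EuclideanSpace ℝ (Fin n) →L[ℝ] EuclideanSpace ℝ (Fin n)) : Orth n :=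
  Unitary.linearIsometryEquiv.symm
    (gramSchmidtOrthonormalBasis finrank_euclideanSpace (columns a)).repr.symm

theorem orthPart_apply (a : 𝔽 →L[ℝ] 𝔽) (v : 𝔽) :
    (orthPart a).1 v
      = ∑ i, v i • gramSchmidtOrthonormalBasis finrank_euclideanSpace (columns a) i :=
  (OrthonormalBasis.sum_repr_symm _ v).symm

theorem gramSchmidtOrthonormalBasis_columns {a : 𝔽 →L[ℝ] 𝔽} (ha : Function.Injective a)
    (i : Fin n) :
    gramSchmidtOrthonormalBasis finrank_euclideanSpace (columns a) i
      = ‖gramSchmidt ℝ (columns a) i‖⁻¹ • gramSchmidt ℝ (columns a) i :=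
  gramSchmidtOrthonormalBasis_apply _ <| norm_ne_zero_iff.1 <| by
    rw [gramSchmidtNormed_unit_length i (linearIndependent_columns.2 ha)]
    exact one_ne_zero

theorem columns_orthPart (a : 𝔽 →L[ℝ] 𝔽) :
    columns (orthPart a).1
      = gramSchmidtOrthonormalBasis finrank_euclideanSpace (columns a) := by
  funext i
  change (orthPart a).1 (EuclideanSpace.basisFun (Fin n) ℝ i) = _
  rw [EuclideanSpace.basisFun_apply]
  exact OrthonormalBasis.repr_symm_single _ i

theorem columns_injective : Function.Injective (columns : (𝔽 →L[ℝ] 𝔽) → _) := fun _ _ h =>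
  ContinuousLinearMap.coe_injective
    ((EuclideanSpace.basisFun (Fin n) ℝ).toBasis.ext fun i => congr_fun h i)

theorem orthPart_of_unitary (a : Orth n) : orthPart a.1 = a := by
  have horth : Orthonormal ℝ (columns a.1) :=
    (EuclideanSpace.basisFun (Fin n) ℝ).orthonormal.comp_linearIsometry
      (Unitary.linearIsometryEquiv a).toLinearIsometry
  refine Subtype.ext (columns_injective ?_)
  rw [columns_orthPart]
  funext i
  rw [gramSchmidtOrthonormalBasis_apply_of_orthogonal _ horth.2 (horth.ne_zero i), horth.1 i]
  simp

section Segment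

variable {a : EuclideanSpace ℝ (Fin n) →L[ℝ] EuclideanSpace ℝ (Fin n)} {t : ℝ}

-- The triangular factor moves along the segment from it to `1`, so its diagonal stays positive.
theorem exists_pos_gramSchmidt_columns_segment (ha : Function.Injective a) (ht : t ∈ Icc 0 1)
    (i : Fin n) :
    ∃ c : ℝ, 0 < c ∧ gramSchmidt ℝ (columns ((1 - t) • (orthPart a).1 + t • a)) i
      = c • gramSchmidt ℝ (columns a) i := by
  have hpos (i) : 0 < (1 - t) * ‖gramSchmidt ℝ (columns a) i‖⁻¹ + t := by
    have hinv := inv_pos.2 (norm_pos_iff.2 (gramSchmidt_ne_zero i (linearIndependent_columns.2 ha)))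
    nlinarith [ht.1, ht.2, mul_nonneg (sub_nonneg.2 ht.2) hinv.le]
  refine ⟨_, hpos i,
    gramSchmidt_eq_smul (c := fun i => (1 - t) * ‖gramSchmidt ℝ (columns a) i‖⁻¹ + t)
    (fun i => (hpos i).ne') (fun i => ?_) i⟩
  have hdiff : columns ((1 - t) • (orthPart a).1 + t • a) i
      - ((1 - t) * ‖gramSchmidt ℝ (columns a) i‖⁻¹ + t) • gramSchmidt ℝ (columns a) i
      = -t • (gramSchmidt ℝ (columns a) i - columns a i) := by
    change (1 - t) • columns (orthPart a).1 i + t • columns a i - _ = _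
    rw [columns_orthPart, gramSchmidtOrthonormalBasis_columns ha]
    module
  rw [hdiff]
  exact Submodule.smul_mem _ _ (gramSchmidt_sub_mem_span _ i)

theorem injective_segment_orthPart (ha : Function.Injective a) (ht : t ∈ Icc 0 1) :
    Function.Injective ((1 - t) • (orthPart a).1 + t • a) := by
  refine linearIndependent_columns.1 (linearIndependent_of_gramSchmidt_ne_zero fun i => ?_)
  obtain ⟨c, hc, h⟩ := exists_pos_gramSchmidt_columns_segment ha ht i
  rw [h]
  exact smul_ne_zero hc.ne' (gramSchmidt_ne_zero i (linearIndependent_columns.2 ha))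

theorem orthPart_segment (ha : Function.Injective a) (ht : t ∈ Icc 0 1) :
    orthPart ((1 - t) • (orthPart a).1 + t • a) = orthPart a := by
  refine Subtype.ext (columns_injective ?_)
  rw [columns_orthPart, columns_orthPart]
  funext i
  obtain ⟨c, hc, h⟩ := exists_pos_gramSchmidt_columns_segment ha ht i
  rw [gramSchmidtOrthonormalBasis_columns (injective_segment_orthPart ha ht), h,
    gramSchmidtOrthonormalBasis_columns ha, norm_smul, Real.norm_of_nonneg hc.le, smul_smul,
    mul_inv_rev, mul_assoc, inv_mul_cancel₀ hc.ne', mul_one]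

end Segment

theorem continuous_orthPart {X : Type*} [TopologicalSpace X] {f : X → 𝔽 →L[ℝ] 𝔽}
    (hf : Continuous f) (hinj : ∀ x, Function.Injective (f x)) :
    Continuous fun x => orthPart (f x) := by
  refine continuous_induced_rng.2 (continuous_clm_apply.2 fun v => ?_)
  change Continuous fun x => (orthPart (f x)).1 v
  simp only [orthPart_apply, gramSchmidtOrthonormalBasis_columns (hinj _)]
  refine continuous_finsetSum _ fun i _ => continuous_iff_continuousAt.2 fun x => ?_
  have hx := linearIndependent_columns.2 (hinj x)
  have hcolumns (j) : Continuous fun y => columns (f y) j :=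
    hf.clm_apply (g := fun _ => EuclideanSpace.basisFun (Fin n) ℝ j) continuous_const
  have h := continuousAt_gramSchmidt (fun j => (hcolumns j).continuousAt) hx i
  have hnorm := h.norm.inv₀ (norm_ne_zero_iff.2 (gramSchmidt_ne_zero i hx))
  have hnormed : ContinuousAt (fun y => ‖gramSchmidt ℝ (columns (f y)) i‖⁻¹ •
      gramSchmidt ℝ (columns (f y)) i) x := hnorm.smul h
  exact hnormed.const_smul (v i)

end OrthogonalPart

section Cone

open Set
open scoped unitInterval

variable {n : ℕ} {W : Type*} [NormedAddCommGroup W] [NormedSpace ℝ W]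
local notation "𝔽" => EuclideanSpace ℝ (Fin n)

variable (n W) in
/-- The monoid of operators on `ℝⁿ × W` that preserve the open cone of positive vectors of the form
`‖v‖² - ‖w‖²`. It contains every linear isometry of that form. -/
def coneMonoid :
    Submonoid ((EuclideanSpace ℝ (Fin n) × W) →L[ℝ] (EuclideanSpace ℝ (Fin n) × W)) where
  carrier := {m | ∀ u, ‖u.2‖ < ‖u.1‖ → ‖(m u).2‖ < ‖(m u).1‖}
  one_mem' := fun _ hu => hu
  mul_mem' := fun ha hb u hu => ha _ (hb u hu)

variable (n W) in
/-- The operators in the cone monoid that do not change the norm of the first component of a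
vector. The orthogonal part of the upper left block is multiplicative on them. -/
def fstIsometries : Submonoid (coneMonoid n W) where
  carrier := {m | ∀ u, ‖(m.1 u).1‖ = ‖u.1‖}
  one_mem' := fun _ => rfl
  mul_mem' := fun ha hb u => (ha _).trans (hb u)

/-- The upper left block of an operator on `ℝⁿ × W`. -/
def corner (m : (EuclideanSpace ℝ (Fin n) × W) →L[ℝ] (EuclideanSpace ℝ (Fin n) × W)) :
    EuclideanSpace ℝ (Fin n) →L[ℝ] EuclideanSpace ℝ (Fin n) :=
  (ContinuousLinearMap.fst ℝ 𝔽 W).comp (m.comp (ContinuousLinearMap.inl ℝ 𝔽 W))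

theorem continuous_corner : Continuous (corner : ((𝔽 × W) →L[ℝ] (𝔽 × W)) → 𝔽 →L[ℝ] 𝔽) :=
  continuous_const.clm_comp (continuous_id.clm_comp continuous_const)

theorem injective_corner (m : coneMonoid n W) : Function.Injective (corner m.1) := by
  refine (injective_iff_map_eq_zero _).2 fun v hv => ?_
  by_contra h
  have hpos : ‖(m.1 (v, 0)).2‖ < ‖corner m.1 v‖ := m.2 (v, 0) (by simpa using h)
  rw [hv, norm_zero] at hpos
  exact (norm_nonneg _).not_gt hpos

/-- The orthogonal part of the upper left block. -/
def rot : C(coneMonoid n W, Orth n) where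
  toFun m := orthPart (corner m.1)
  continuous_toFun :=
    continuous_orthPart (continuous_corner.comp continuous_subtype_val) injective_corner

section FstIsometries

variable {m : coneMonoid n W}

theorem coe_rot (hm : m ∈ fstIsometries n W) : (rot m).1 = corner m.1 := by
  have hnorm (v) : ‖corner m.1 v‖ = ‖v‖ := hm (v, 0)
  let e : 𝔽 ≃ₗᵢ[ℝ] 𝔽 :=
    LinearIsometry.toLinearIsometryEquiv ⟨(corner m.1).toLinearMap, hnorm⟩ rfl
  exact congrArg Subtype.val (orthPart_of_unitary (Unitary.linearIsometryEquiv.symm e))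

theorem fst_apply_eq_corner (hm : m ∈ fstIsometries n W) (u : 𝔽 × W) :
    (m.1 u).1 = corner m.1 u.1 := by
  have hzero : (m.1 (0, u.2)).1 = 0 := norm_eq_zero.1 ((hm (0, u.2)).trans norm_zero)
  have hu : u = (u.1, 0) + (0, u.2) := by simp
  conv_lhs => rw [hu, map_add, Prod.fst_add, hzero, add_zero]
  rfl

theorem rot_mul {k : coneMonoid n W} (hm : m ∈ fstIsometries n W) (hk : k ∈ fstIsometries n W) :
    rot (m * k) = rot m * rot k := by
  refine Subtype.ext (ContinuousLinearMap.ext fun v => ?_)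
  rw [coe_rot (mul_mem hm hk), Submonoid.coe_mul (unitary _), coe_rot hm, coe_rot hk]
  exact fst_apply_eq_corner hm (k.1 (v, 0))

end FstIsometries

section Deformation

/-- The operator `diag(a, 0)` on `ℝⁿ × W`. -/
def diagFst (W : Type*) [NormedAddCommGroup W] [NormedSpace ℝ W]
    (a : EuclideanSpace ℝ (Fin n) →L[ℝ] EuclideanSpace ℝ (Fin n)) :
    (EuclideanSpace ℝ (Fin n) × W) →L[ℝ] (EuclideanSpace ℝ (Fin n) × W) :=
  (ContinuousLinearMap.inl ℝ 𝔽 W).comp (a.comp (ContinuousLinearMap.fst ℝ 𝔽 W))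

theorem diagFst_mem_coneMonoid {a : 𝔽 →L[ℝ] 𝔽} (ha : Function.Injective a) :
    diagFst W a ∈ coneMonoid n W := fun u hu => by
  have hu0 : u.1 ≠ 0 := norm_pos_iff.1 ((norm_nonneg _).trans_lt hu)
  change ‖(0 : W)‖ < ‖a u.1‖
  rw [norm_zero, norm_pos_iff]
  exact (map_ne_zero_iff a ha).2 hu0

variable (n W) in
/-- The operator `diag(1, t)` on `ℝⁿ × W`. -/
def scaleSnd (t : ℝ) : (EuclideanSpace ℝ (Fin n) × W) →L[ℝ] (EuclideanSpace ℝ (Fin n) × W) :=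
  (ContinuousLinearMap.fst ℝ (EuclideanSpace ℝ (Fin n)) W).prod
    (t • ContinuousLinearMap.snd ℝ (EuclideanSpace ℝ (Fin n)) W)

theorem scaleSnd_mem_coneMonoid {t : ℝ} (ht : t ∈ Icc 0 1) :
    scaleSnd n W t ∈ coneMonoid n W := fun u hu => by
  change ‖t • u.2‖ < ‖u.1‖
  refine lt_of_le_of_lt ?_ hu
  rw [norm_smul, Real.norm_of_nonneg ht.1]
  exact mul_le_of_le_one_left (norm_nonneg _) ht.2

theorem continuous_scaleSnd : Continuous (scaleSnd n W) := by
  have h : scaleSnd n W = fun t => (ContinuousLinearMap.inl ℝ 𝔽 W).comp (.fst ℝ 𝔽 W)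
      + t • (ContinuousLinearMap.inr ℝ 𝔽 W).comp (.snd ℝ 𝔽 W) := by
    funext t
    ext <;> simp [scaleSnd]
  rw [h]
  fun_prop

/-- The path `diag((1 - t) rot m + t corner m, 0)` of operators. -/
def straighten : C(I × coneMonoid n W, coneMonoid n W) where
  toFun p := ⟨diagFst W ((1 - p.1 : ℝ) • (rot p.2).1 + (p.1 : ℝ) • corner p.2.1),
    diagFst_mem_coneMonoid (injective_segment_orthPart (injective_corner p.2) p.1.2)⟩
  continuous_toFun := by
    have hrot : Continuous fun p : I × coneMonoid n W => (rot p.2).1 :=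
      continuous_subtype_val.comp (rot.continuous.comp continuous_snd)
    have hcorner : Continuous fun p : I × coneMonoid n W => corner p.2.1 :=
      continuous_corner.comp (by fun_prop)
    have hsegment : Continuous fun p : I × coneMonoid n W =>
        (1 - p.1 : ℝ) • (rot p.2).1 + (p.1 : ℝ) • corner p.2.1 := by fun_prop
    exact (continuous_const.clm_comp (hsegment.clm_comp continuous_const)).subtype_mk _

theorem isFibrewise_straighten (t : I) :
    IsFibrewise rot (fstIsometries n W) (straighten.curry t) := by
  refine ⟨fun m => orthPart_segment (injective_corner m) t.2, fun m hm u => ?_⟩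
  change ‖(1 - t : ℝ) • (rot m).1 u.1 + (t : ℝ) • corner m.1 u.1‖ = _
  rw [← coe_rot hm, ← add_smul, sub_add_cancel, one_smul, Unitary.norm_map]

theorem straighten_zero_mem (m : coneMonoid n W) : straighten (0, m) ∈ fstIsometries n W :=
  fun u => by
  change ‖(1 - 0 : ℝ) • (rot m).1 u.1 + (0 : ℝ) • corner m.1 u.1‖ = _
  rw [sub_zero, one_smul, zero_smul, add_zero, Unitary.norm_map]

/-- The path `diag(1, t) m diag(1, t)` of operators. -/
def unscale : C(I × coneMonoid n W, coneMonoid n W) where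
  toFun p := ⟨scaleSnd n W p.1, scaleSnd_mem_coneMonoid p.1.2⟩ * p.2 *
    ⟨scaleSnd n W p.1, scaleSnd_mem_coneMonoid p.1.2⟩
  continuous_toFun := by
    have hscale : Continuous fun p : I × coneMonoid n W => scaleSnd n W p.1 :=
      continuous_scaleSnd.comp (by fun_prop)
    have := hscale.subtype_mk fun p => scaleSnd_mem_coneMonoid p.1.2
    fun_prop

theorem unscale_apply (t : I) (m : coneMonoid n W) (u : 𝔽 × W) :
    (unscale (t, m)).1 u
      = ((m.1 (u.1, (t : ℝ) • u.2)).1, (t : ℝ) • (m.1 (u.1, (t : ℝ) • u.2)).2) :=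
  rfl

theorem corner_unscale (t : I) (m : coneMonoid n W) :
    corner (unscale (t, m)).1 = corner m.1 := by
  ext1 v
  change (m.1 (v, (t : ℝ) • (0 : W))).1 = (m.1 (v, 0)).1
  rw [smul_zero]

theorem isFibrewise_unscale (t : I) : IsFibrewise rot (fstIsometries n W) (unscale.curry t) :=
  ⟨fun m => congrArg orthPart (corner_unscale t m), fun _ hm u => hm (u.1, (t : ℝ) • u.2)⟩

theorem straighten_one (m : coneMonoid n W) : straighten (1, m) = unscale (0, m) := by
  refine Subtype.ext (ContinuousLinearMap.ext fun u => ?_)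
  rw [unscale_apply]
  change ((1 - 1 : ℝ) • (rot m).1 u.1 + (1 : ℝ) • corner m.1 u.1, (0 : W)) =
    ((m.1 (u.1, (0 : ℝ) • u.2)).1, (0 : ℝ) • (m.1 (u.1, (0 : ℝ) • u.2)).2)
  rw [sub_self, zero_smul, zero_smul, zero_smul, one_smul, zero_add]
  rfl

theorem unscale_one (m : coneMonoid n W) : unscale (1, m) = m := by
  refine Subtype.ext (ContinuousLinearMap.ext fun u => ?_)
  rw [unscale_apply]
  change ((m.1 (u.1, (1 : ℝ) • u.2)).1, (1 : ℝ) • (m.1 (u.1, (1 : ℝ) • u.2)).2) = m.1 u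
  rw [one_smul, one_smul]

theorem exists_homotopicWith_id_isFibrewise :
    ∃ f₀ : C(coneMonoid n W, coneMonoid n W), (∀ m, f₀ m ∈ fstIsometries n W) ∧
      f₀.HomotopicWith (.id _) (IsFibrewise rot (fstIsometries n W)) := by
  let F₁ : (straighten.curry 0).HomotopyWith (straighten.curry 1)
      (IsFibrewise rot (fstIsometries n W)) :=
    { straighten with
      map_zero_left := fun _ => rfl
      map_one_left := fun _ => rfl
      prop' := isFibrewise_straighten }
  let F₂ : (straighten.curry 1).HomotopyWith (.id _) (IsFibrewise rot (fstIsometries n W)) :=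
    { unscale with
      map_zero_left := fun m => (straighten_one m).symm
      map_one_left := unscale_one
      prop' := isFibrewise_unscale }
  exact ⟨straighten.curry 0, straighten_zero_mem, ⟨F₁.trans F₂⟩⟩

end Deformation

end Cone

section ConeRepresentation

theorem exists_isometry_of_pos_def {V : Type*} [AddCommGroup V] [Module ℝ V]
    [FiniteDimensional ℝ V] (B : LinearMap.BilinForm ℝ V) (hsymm : ∀ v w, B v w = B w v)
    (hpos : ∀ v, v ≠ 0 → 0 < B v v) :
    ∃ (n : ℕ) (Ψ : EuclideanSpace ℝ (Fin n) ≃ₗ[ℝ] V), ∀ v w, B (Ψ v) (Ψ w) = inner ℝ v w := by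
  let core : InnerProductSpace.Core ℝ V :=
    { inner := fun v w => B v w
      conj_inner_symm := fun v w => hsymm w v
      re_inner_nonneg := fun v => by
        rcases eq_or_ne v 0 with rfl | hv
        · simp
        · exact (hpos v hv).le
      add_left := fun u v w => by simp
      smul_left := fun u v r => by simp
      definite := fun v => Function.mtr fun hv => (hpos v hv).ne' }
  let : NormedAddCommGroup V := core.toNormedAddCommGroup
  let : InnerProductSpace ℝ V := InnerProductSpace.ofCore core.toCore
  let e := (stdOrthonormalBasis ℝ V).repr.symm
  exact ⟨_, e.toLinearEquiv, fun v w => e.inner_map_map v w⟩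

variable {n : ℕ} {W V G : Type*} [NormedAddCommGroup W] [NormedSpace ℝ W] [FiniteDimensional ℝ W]
  [AddCommGroup V] [Module ℝ V] [Group G] (Φ : (EuclideanSpace ℝ (Fin n) × W) ≃ₗ[ℝ] V)
  (r : Representation ℝ G V)

/-- A representation preserving the quadratic form `‖v‖² - ‖w‖²`, in coordinates. -/
def coneRep (h : ∀ g u, ‖(Φ.symm (r g (Φ u))).1‖ ^ 2 - ‖(Φ.symm (r g (Φ u))).2‖ ^ 2
      = ‖u.1‖ ^ 2 - ‖u.2‖ ^ 2) : G →* coneMonoid n W where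
  toFun g := ⟨LinearMap.toContinuousLinearMap
      (Φ.symm.toLinearMap ∘ₗ r g ∘ₗ Φ.toLinearMap), fun u hu => by
    have hsq := pow_lt_pow_left₀ hu (norm_nonneg _) two_ne_zero
    exact lt_of_pow_lt_pow_left₀ 2 (norm_nonneg _)
      (sub_pos.1 ((sub_pos.2 hsq).trans_eq (h g u).symm))⟩
  map_one' := Subtype.ext <| ContinuousLinearMap.ext fun u => by
    change Φ.symm (r 1 (Φ u)) = u
    rw [map_one]
    exact Φ.symm_apply_apply u
  map_mul' g k := Subtype.ext <| ContinuousLinearMap.ext fun u => by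
    change Φ.symm (r (g * k) (Φ u)) = Φ.symm (r g (Φ (Φ.symm (r k (Φ u)))))
    rw [map_mul, Φ.apply_symm_apply]
    rfl

variable {Φ r}

theorem continuous_coneRep [TopologicalSpace V] [IsTopologicalAddGroup V] [ContinuousSMul ℝ V]
    [T2Space V] [FiniteDimensional ℝ V] [TopologicalSpace G] (h)
    (hr : ∀ v, Continuous fun g => r g v) : Continuous (coneRep Φ r h) := by
  refine Continuous.subtype_mk (continuous_clm_apply.2 fun u => ?_) _
  exact (LinearMap.continuous_of_finiteDimensional Φ.symm.toLinearMap).comp (hr (Φ u))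

end ConeRepresentation

/-! ### The adjoint representation and the Cartan decomposition -/

theorem inTangentCoordinates_of_eq {𝕜 E E' H H' M M' N : Type*} [NontriviallyNormedField 𝕜]
    [NormedAddCommGroup E] [NormedSpace 𝕜 E] [NormedAddCommGroup E'] [NormedSpace 𝕜 E']
    [TopologicalSpace H] [TopologicalSpace H'] {I : ModelWithCorners 𝕜 E H}
    {I' : ModelWithCorners 𝕜 E' H'} [TopologicalSpace M] [ChartedSpace H M] [TopologicalSpace M']
    [ChartedSpace H' M'] [IsManifold I 1 M] [IsManifold I' 1 M'] (f : N → M) (g : N → M')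
    (ϕ : N → E →L[𝕜] E') {x₀ x : N} (hf : f x = f x₀) (hg : g x = g x₀) :
    inTangentCoordinates I I' f g ϕ x₀ x = ϕ x := by
  rw [inTangentCoordinates_eq f g ϕ (hf ▸ mem_chart_source H (f x))
    (hg ▸ mem_chart_source H' (g x)), hf, hg]
  ext v
  rw [ContinuousLinearMap.comp_apply, ContinuousLinearMap.comp_apply,
    (tangentBundleCore I M).coordChange_self _ _ (mem_chart_source H (f x₀)),
    (tangentBundleCore I' M').coordChange_self _ _ (mem_chart_source H' (g x₀))]

section Cartan

variable {d : ℕ} {G : Type u} [TopologicalSpace G] [Group G]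
  [ChartedSpace (EuclideanSpace ℝ (Fin d)) G]

instance : FiniteDimensional ℝ (GroupLieAlgebra (𝓡 d) G) :=
  inferInstanceAs (FiniteDimensional ℝ (EuclideanSpace ℝ (Fin d)))

instance : T2Space (GroupLieAlgebra (𝓡 d) G) :=
  inferInstanceAs (T2Space (EuclideanSpace ℝ (Fin d)))

theorem continuous_Ad_apply [LieGroup (𝓡 d) ∞ G] (v : GroupLieAlgebra (𝓡 d) G) :
    Continuous fun g => Ad d g v := by
  have hmanifold : IsManifold (𝓡 d) 1 G := IsManifold.of_le (n := ∞) (by simp)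
  refine continuous_iff_continuousAt.2 fun g₀ => ?_
  have hconj : ContMDiff ((𝓡 d).prod (𝓡 d)) (𝓡 d) ∞
      (Function.uncurry fun g x : G => g * x * g⁻¹) :=
    (contMDiff_fst.mul contMDiff_snd).mul contMDiff_fst.inv
  have hmfderiv := (ContMDiffAt.mfderiv (m := 0) (x₀ := g₀) (fun g x : G => g * x * g⁻¹)
    (fun _ => (1 : G)) hconj.contMDiffAt contMDiffAt_const (by simp)).continuousAt
  have hAd (g) : Ad d g v = inTangentCoordinates (𝓡 d) (𝓡 d) (fun _ => (1 : G))
      (fun g => g * 1 * g⁻¹) (fun g => mfderiv (𝓡 d) (𝓡 d) (fun x => g * x * g⁻¹) 1) g₀ g v :=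
    (DFunLike.congr_fun (inTangentCoordinates_of_eq (I := 𝓡 d) (I' := 𝓡 d)
      (fun _ => (1 : G)) (fun g : G => g * 1 * g⁻¹)
      (fun g => mfderiv (𝓡 d) (𝓡 d) (fun x => g * x * g⁻¹) 1) rfl (by simp)) v).symm
  simp only [hAd]
  exact hmfderiv.clm_apply continuousAt_const

variable {K : Subgroup G} {θ : G ≃* G}

theorem mem_p₀_iff {X : GroupLieAlgebra (𝓡 d) G} : X ∈ p₀ d θ ↔ diffOne d θ X = -X := by
  rw [p₀, Module.End.mem_eigenspace_iff, neg_one_smul]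

theorem mem_k₀_iff {X : GroupLieAlgebra (𝓡 d) G} : X ∈ k₀ d θ ↔ diffOne d θ X = X := by
  rw [k₀, Module.End.mem_eigenspace_iff, one_smul]

theorem diffOne_involutive (h : IsCartanInvolution d K θ) (X : GroupLieAlgebra (𝓡 d) G) :
    diffOne d θ (diffOne d θ X) = X := by
  have hcomp := diffOne_comp d h.smooth h.smooth (map_one θ)
  rw [show (fun x => θ (θ x)) = fun x : G => x from funext h.involutive, diffOne_id] at hcomp
  exact (LinearMap.congr_fun hcomp X).symm

theorem isCompl_p₀_k₀ (h : IsCartanInvolution d K θ) : IsCompl (p₀ d θ) (k₀ d θ) := by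
  refine ⟨?_, codisjoint_iff_le_sup.2 fun X _ => ?_⟩
  · exact (diffOne d θ).eigenspaces_iSupIndep.pairwiseDisjoint (by norm_num : (-1 : ℝ) ≠ 1)
  · refine Submodule.mem_sup.2 ⟨(1 / 2 : ℝ) • (X - diffOne d θ X), ?_,
      (1 / 2 : ℝ) • (X + diffOne d θ X), ?_, ?_⟩
    · rw [mem_p₀_iff, map_smul, map_sub, diffOne_involutive h, ← smul_neg, neg_sub]
    · rw [mem_k₀_iff, map_smul, map_add, diffOne_involutive h, add_comm]
    · module

variable {n : ℕ} {Ψ : EuclideanSpace ℝ (Fin n) ≃ₗ[ℝ] p₀ d θ}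

variable (Ψ) in
/-- An orthonormal real basis of `𝔭₀`, as a basis of `𝔭`. -/
def complexBasis : Module.Basis (Fin n) ℂ (P d θ) :=
  ((EuclideanSpace.basisFun (Fin n) ℝ).toBasis.map Ψ).baseChange ℂ

theorem complexBasis_apply (i : Fin n) :
    complexBasis Ψ i = 1 ⊗ₜ Ψ (EuclideanSpace.single i 1) := by
  simp [complexBasis]

theorem realVec_complexBasis (v : EuclideanSpace ℝ (Fin n)) :
    realVec (complexBasis Ψ) v = 1 ⊗ₜ Ψ v := by
  rw [← (EuclideanSpace.basisFun (Fin n) ℝ).sum_repr v, map_sum, map_sum, TensorProduct.tmul_sum]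
  refine Finset.sum_congr rfl fun i _ => ?_
  rw [map_smul, map_smul, TensorProduct.tmul_smul, EuclideanSpace.basisFun_apply, realVec_single,
    complexBasis_apply]

variable {W : Type*} [NormedAddCommGroup W] [NormedSpace ℝ W] {Ψ' : W ≃ₗ[ℝ] k₀ d θ}

variable (Ψ Ψ') in
/-- The coordinates on `𝔤₀ = 𝔭₀ ⊕ 𝔨₀` given by coordinates on `𝔭₀` and `𝔨₀`. -/
def cartanCoordinates (h : IsCartanInvolution d K θ) :
    (EuclideanSpace ℝ (Fin n) × W) ≃ₗ[ℝ] GroupLieAlgebra (𝓡 d) G :=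
  (Ψ.prodCongr Ψ').trans (Submodule.prodEquivOfIsCompl _ _ (isCompl_p₀_k₀ h))

variable {h : IsCartanInvolution d K θ}

theorem cartanCoordinates_apply (u : EuclideanSpace ℝ (Fin n) × W) :
    cartanCoordinates Ψ Ψ' h u = (Ψ u.1 : GroupLieAlgebra (𝓡 d) G) + Ψ' u.2 := rfl

variable [LieGroup (𝓡 d) ∞ G] {B : LinearMap.BilinForm ℝ (GroupLieAlgebra (𝓡 d) G)}

theorem Ad_mem_k₀ (h : IsCartanInvolution d K θ) (hB : IsInvariantForm d θ B)
    (k : K) {X : GroupLieAlgebra (𝓡 d) G} (hX : X ∈ k₀ d θ) : Ad d k.1 X ∈ k₀ d θ := by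
  obtain ⟨Y, hY, Z, hZ, hYZ⟩ := Submodule.mem_sup.1
    ((isCompl_p₀_k₀ h).codisjoint.eq_top ▸ Submodule.mem_top (x := Ad d k.1 X))
  have hinv : Ad d k.1 (Ad d (k⁻¹ : K).1 Y) = Y := by
    rw [← Module.End.mul_apply, ← map_mul]
    simp
  have horth : B (Ad d k.1 X) Y = 0 := by
    rw [← hinv, hB.invariant]
    exact (hB.orthogonal _).1 (Ad_mem_p₀ h k⁻¹ hY) X hX
  have hYY : B Y Y = 0 := by
    rwa [← hYZ, map_add, LinearMap.add_apply, (hB.orthogonal _).1 hY Z hZ, add_zero] at horth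
  have hY0 : Y = 0 := Function.mtr (fun hne => (hB.pos_def Y hY hne).ne') hYY
  rwa [← hYZ, hY0, zero_add]

theorem isOrthonormalFor_complexBasis (hB : IsInvariantForm d θ B)
    (hΨ : ∀ v w, B (Ψ v) (Ψ w) = inner ℝ v w) :
    IsOrthonormalFor (q θ B) (complexBasis Ψ) := by
  intro x
  have hassoc : QuadraticMap.associated (q θ B)
      = LinearMap.BilinForm.baseChange ℂ (B.restrict (p₀ d θ)) := by
    rw [q, QuadraticForm.associated_baseChange, QuadraticMap.associated_left_inverse ℝ]
    exact fun X Y => hB.symm X Y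
  have hgram (i j : Fin n) : (B.restrict (p₀ d θ)) (Ψ (EuclideanSpace.single i 1))
      (Ψ (EuclideanSpace.single j 1)) = if i = j then 1 else 0 := by
    refine (hΨ _ _).trans ?_
    simp [EuclideanSpace.inner_single_left]
  rw [← QuadraticMap.associated_eq_self_apply ℂ (q θ B), hassoc]
  simp only [map_sum, map_smul, LinearMap.sum_apply, LinearMap.smul_apply, complexBasis_apply,
    LinearMap.BilinForm.baseChange_tmul, hgram]
  simp [sq]

theorem form_cartanCoordinates (hB : IsInvariantForm d θ B)
    (hΨ : ∀ v, B (Ψ v) (Ψ v) = ‖v‖ ^ 2) (hΨ' : ∀ w, B (Ψ' w) (Ψ' w) = -‖w‖ ^ 2) (u) :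
    B (cartanCoordinates Ψ Ψ' h u) (cartanCoordinates Ψ Ψ' h u) = ‖u.1‖ ^ 2 - ‖u.2‖ ^ 2 := by
  have horth : B (Ψ' u.2) (Ψ u.1) = 0 := (hB.orthogonal _).1 (Ψ u.1).2 _ (Ψ' u.2).2
  have horth' : B (Ψ u.1) (Ψ' u.2) = 0 := (hB.symm _ _).trans horth
  rw [cartanCoordinates_apply, map_add, map_add, LinearMap.add_apply, LinearMap.add_apply, horth,
    horth', hΨ, hΨ']
  ring

theorem form_Ad_cartanCoordinates (hB : IsInvariantForm d θ B)
    (hΨ : ∀ v, B (Ψ v) (Ψ v) = ‖v‖ ^ 2) (hΨ' : ∀ w, B (Ψ' w) (Ψ' w) = -‖w‖ ^ 2) (g : G) (u) :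
    let Φ := cartanCoordinates Ψ Ψ' h
    ‖(Φ.symm (Ad d g (Φ u))).1‖ ^ 2 - ‖(Φ.symm (Ad d g (Φ u))).2‖ ^ 2
      = ‖u.1‖ ^ 2 - ‖u.2‖ ^ 2 := by
  intro Φ
  rw [← form_cartanCoordinates (h := h) hB hΨ hΨ', ← form_cartanCoordinates (h := h) hB hΨ hΨ',
    LinearEquiv.apply_symm_apply, hB.invariant]

theorem fst_symm_Ad_cartanCoordinates (hB : IsInvariantForm d θ B) (k : K) (u) :
    ((cartanCoordinates Ψ Ψ' h).symm (Ad d k.1 (cartanCoordinates Ψ Ψ' h u))).1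
      = Ψ.symm (AdReal h k (Ψ u.1)) := by
  suffices (cartanCoordinates Ψ Ψ' h).symm (Ad d k.1 (cartanCoordinates Ψ Ψ' h u))
      = (Ψ.symm (AdReal h k (Ψ u.1)), Ψ'.symm ⟨_, Ad_mem_k₀ h hB k (Ψ' u.2).2⟩) from
    congrArg Prod.fst this
  rw [LinearEquiv.symm_apply_eq, cartanCoordinates_apply, cartanCoordinates_apply, map_add,
    LinearEquiv.apply_symm_apply, LinearEquiv.apply_symm_apply]
  rfl

theorem norm_symm_AdReal (hB : IsInvariantForm d θ B) (hΨ : ∀ v, B (Ψ v) (Ψ v) = ‖v‖ ^ 2)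
    (k : K) (v : EuclideanSpace ℝ (Fin n)) : ‖Ψ.symm (AdReal h k (Ψ v))‖ = ‖v‖ := by
  refine (sq_eq_sq₀ (norm_nonneg _) (norm_nonneg _)).1 ?_
  rw [← hΨ, ← hΨ, LinearEquiv.apply_symm_apply]
  exact hB.invariant _ _ _

theorem det_AdReal {k : K} (hk : AdP h k ∈ SO (q θ B)) : LinearMap.det (AdReal h k) = 1 := by
  have hdet : LinearMap.det ((AdReal h k).baseChange ℂ) = 1 := hk.2
  rw [LinearMap.det_baseChange] at hdet
  exact Complex.ofReal_injective hdet

end Cartan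

/-! ### Double coverings and the spin group -/

theorem isCoveringMap_fst {X F : Type*} [TopologicalSpace X] [TopologicalSpace F]
    [DiscreteTopology F] : IsCoveringMap (Prod.fst : X × F → X) := fun x =>
  have h : IsEvenlyCovered (Prod.fst : X × F → X) x F :=
    ⟨‹_›, Set.univ, Set.mem_univ x, isOpen_univ, isOpen_univ,
      (Homeomorph.Set.univ _).trans ((Homeomorph.Set.univ X).symm.prodCongr (.refl F)),
      fun _ => rfl⟩
  h.to_isEvenlyCovered_preimage

theorem factorsOverSpin_of_subsingleton {L V : Type*} [Group L] [TopologicalSpace L]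
    [AddCommGroup V] [Module ℂ V] [Subsingleton V] (q : QuadraticForm ℂ V)
    (τ : Representation ℂ L V) : FactorsOverSpin q τ :=
  ⟨1, continuous_const, MonoidHom.ext fun _ => LinearMap.ext fun _ => Subsingleton.elim _ _⟩

section DoubleCoverings

variable {d : ℕ} {G : Type u} [TopologicalSpace G] [Group G]
  [ChartedSpace (EuclideanSpace ℝ (Fin d)) G] [LieGroup (𝓡 d) ∞ G]

theorem exists_isDoubleCovering {G' : Type u} [TopologicalSpace G'] [Group G']
    [IsTopologicalGroup G'] (β : G' →* G) (hβ : IsCoveringMap β) (hsurj : Function.Surjective β)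
    (hker : Nat.card β.ker = 2) :
    ∃ (_ : ChartedSpace (EuclideanSpace ℝ (Fin d)) G') (_ : LieGroup (𝓡 d) ∞ G'),
      IsDoubleCovering d β := by
  let := pullbackChartedSpace (H := EuclideanSpace ℝ (Fin d)) hβ.isLocalHomeomorph
  exact ⟨this, pullback_lieGroup β hβ.isLocalHomeomorph, hβ,
    pullback_isLocalDiffeomorph hβ.isLocalHomeomorph ∞, hsurj, hker⟩

variable {V : Type*} [AddCommGroup V] [Module ℂ V] {q : QuadraticForm ℂ V} {K : Subgroup G}
  {τ : Representation ℂ K V}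

theorem exists_doubleCovering_of_factorsOverSpin (hτ : FactorsOverSpin q τ) :
    ∃ (G' : Type u) (_ : TopologicalSpace G') (_ : Group G')
      (_ : ChartedSpace (EuclideanSpace ℝ (Fin d)) G') (_ : LieGroup (𝓡 d) ∞ G')
      (β : G' →* G),
      IsDoubleCovering d β ∧ β.ker ≤ Subgroup.center G' ∧
        FactorsOverSpin q (τ.comp (β.subgroupComap K)) := by
  have hG : IsTopologicalGroup G := topologicalGroup_of_lieGroup (𝓡 d) ∞
  let β := MonoidHom.fst G ℤˣ
  have hker : Nat.card β.ker = 2 := by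
    refine Nat.card_eq_two_iff.2 ⟨1, ⟨(1, -1), rfl⟩, fun h => ?_, Set.eq_univ_of_forall ?_⟩
    · exact (by decide : (1 : ℤˣ) ≠ -1) (congrArg (·.1.2) h)
    · rintro ⟨⟨x, u⟩, hx⟩
      obtain rfl : x = 1 := hx
      rcases Int.units_eq_one_or u with rfl | rfl
      exacts [Or.inl rfl, Or.inr rfl]
  obtain ⟨hcharted, hLie, hβ⟩ := exists_isDoubleCovering (d := d) β isCoveringMap_fst
    Prod.fst_surjective hker
  obtain ⟨φ, hφ, rfl⟩ := hτ
  exact ⟨_, _, _, hcharted, hLie, β, hβ, normal_le_center_of_card_eq_two hker,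
    φ.comp (β.subgroupComap K),
    hφ.comp ((continuous_fst.comp continuous_subtype_val).subtype_mk _), rfl⟩

end DoubleCoverings

section PinExtension

universe v

variable {n : ℕ} {V : Type v} [AddCommGroup V] [Module ℂ V] {q : QuadraticForm ℂ V}
  {E : Module.Basis (Fin n) ℂ V}

theorem factorsOverSpin_of_pinProj (hE : IsOrthonormalFor q E) {L : Type*} [Group L]
    [TopologicalSpace L]
    {φ : L →* Pin q E} (hφ : Continuous φ) {τ : Representation ℂ L V}
    (hdet : ∀ x, LinearMap.det
      ((pinProj (φ x)).1 : EuclideanSpace ℝ (Fin n) →ₗ[ℝ] EuclideanSpace ℝ (Fin n)) = 1)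
    (hτ : ∀ x v, τ x (realVec E v) = realVec E ((pinProj (φ x)).1 v)) :
    FactorsOverSpin q τ := by
  have hinvolute (x) : CliffordAlgebra.involute (φ x).1.2.1 = (φ x).1.2.1 := by
    have h : CliffordAlgebra.involute (φ x).1.2.1
        = ((LinearMap.det ((pinProj (φ x)).1 :
          EuclideanSpace ℝ (Fin n) →ₗ[ℝ] EuclideanSpace ℝ (Fin n)) : ℝ) : ℂ) • (φ x).1.2.1 :=
      involute_eq_det_smul (φ x).2
    rwa [hdet, Complex.ofReal_one, one_smul] at h
  have hspin (x) : (φ x).1.2.1 ∈ spinGroup (-q) :=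
    spinGroup.mem_iff.2 ⟨mem_pinGroup_of_mem_Pin hE (φ x).2, mem_even_of_involute_eq (hinvolute x)⟩
  let ψ : L →* Spin q :=
    { toFun := fun x => ⟨(φ x).1.2.1, hspin x⟩
      map_one' := Subtype.ext (congrArg (·.1.2.1) (map_one φ))
      map_mul' := fun x y => Subtype.ext (congrArg (·.1.2.1) (map_mul φ x y)) }
  have hψ : Continuous ψ := Continuous.subtype_mk (by fun_prop) _
  refine ⟨ψ, hψ, MonoidHom.ext fun x => E.ext fun i => ι_injective q ?_⟩
  change CliffordAlgebra.ι (-q) (spinActVec q (ψ x) (E i)) = CliffordAlgebra.ι (-q) (τ x (E i))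
  have hcomm : (ψ x).1 * γ q E (EuclideanSpace.single i 1)
      = γ q E ((pinProj (φ x)).1 (EuclideanSpace.single i 1)) * (ψ x).1 := by
    have h := involute_mul_γ hE (φ x).2 (EuclideanSpace.single i 1)
    rwa [hinvolute] at h
  have hunit : (ψ x).1 * ((ψ x)⁻¹).1 = 1 := congrArg Subtype.val (mul_inv_cancel (ψ x))
  rw [ι_spinActVec, ← realVec_single E i, hτ, ← γ_apply, hcomm, mul_assoc, hunit, mul_one, γ_apply]

variable {d : ℕ} {G : Type (max u v)} [TopologicalSpace G] [Group G]
  [ChartedSpace (EuclideanSpace ℝ (Fin d)) G] [LieGroup (𝓡 d) ∞ G] [FiniteDimensional ℂ V]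
  [NeZero n] {W : Type*} [NormedAddCommGroup W] [NormedSpace ℝ W] {ρ : G →* coneMonoid n W}

theorem exists_doubleCovering_lift_rot (hE : IsOrthonormalFor q E) (hρ : Continuous ρ) :
    ∃ (G' : Type (max u v)) (_ : TopologicalSpace G') (_ : Group G')
      (_ : ChartedSpace (EuclideanSpace ℝ (Fin d)) G') (_ : LieGroup (𝓡 d) ∞ G')
      (β : G' →* G) (ψ : C(G', Pin q E)),
      IsDoubleCovering d β ∧ (∀ x, pinProj (ψ x) = rot (ρ (β x))) ∧
      ∀ x y, ρ (β x) ∈ fstIsometries n W → ρ (β y) ∈ fstIsometries n W →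
        ψ (x * y) = ψ x * ψ y := by
  have hG : IsTopologicalGroup G := topologicalGroup_of_lieGroup (𝓡 d) ∞
  have hcov := isCoveringMap_pinProj hE
  obtain ⟨f₀, hf₀, ⟨H⟩⟩ := exists_homotopicWith_id_isFibrewise (n := n) (W := W)
  obtain ⟨_, _, hfst, hsnd⟩ :=
    exists_twistedExtension hcov (fun _ ha _ hb => rot_mul ha hb) H hf₀ hρ
  let β : Function.Pullback (rot ∘ ρ) (pinProj : Pin q E → Orth n) →* G :=
    MonoidHom.mk' (fun x => x.fst) hfst
  have hrot : rot (ρ 1) = 1 := by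
    rw [map_one, map_one_of_map_mul fun _ ha _ hb => rot_mul (W := W) ha hb]
  have hker : Nat.card β.ker = 2 :=
    (Nat.card_congr (pullbackFiberEquiv (rot ∘ ρ) pinProj 1)).trans <| by
      rw [Function.comp_apply, hrot]; exact card_ker_pinProj hE
  obtain ⟨hcharted, hLie, hβ⟩ := exists_isDoubleCovering (d := d) β
    (isCoveringMap_pullback_fst hcov (rot.continuous.comp hρ))
    (surjective_pullback_fst (surjective_pinProj hE)) hker
  exact ⟨_, _, _, hcharted, hLie, β,
    ⟨fun x => x.snd, continuous_snd.comp continuous_subtype_val⟩, hβ, fun x => x.2.symm, hsnd⟩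

theorem exists_doubleCovering_of_coneMonoidHom (hE : IsOrthonormalFor q E) (hρ : Continuous ρ)
    {K : Subgroup G} (hfst : ∀ k ∈ K, ρ k ∈ fstIsometries n W)
    (hdet : ∀ k ∈ K, LinearMap.det
      (corner (ρ k).1 : EuclideanSpace ℝ (Fin n) →ₗ[ℝ] EuclideanSpace ℝ (Fin n)) = 1)
    {τ : Representation ℂ K V}
    (hτ : ∀ (k : K) v, τ k (realVec E v) = realVec E (corner (ρ k).1 v)) :
    ∃ (G' : Type (max u v)) (_ : TopologicalSpace G') (_ : Group G')
      (_ : ChartedSpace (EuclideanSpace ℝ (Fin d)) G') (_ : LieGroup (𝓡 d) ∞ G')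
      (β : G' →* G),
      IsDoubleCovering d β ∧ β.ker ≤ Subgroup.center G' ∧
        FactorsOverSpin q (τ.comp (β.subgroupComap K)) := by
  obtain ⟨G', _, _, hcharted, hLie, β, ψ, hβ, hψ, hmul⟩ :=
    exists_doubleCovering_lift_rot (d := d) hE hρ
  let φ : K.comap β →* Pin q E :=
    MonoidHom.mk' (fun x => ψ x) fun x y => hmul x y (hfst _ x.2) (hfst _ y.2)
  have hφ (x : K.comap β) : (pinProj (φ x)).1 = corner (ρ (β x)).1 :=
    (congrArg Subtype.val (hψ x)).trans (coe_rot (hfst _ x.2))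
  exact ⟨G', _, _, hcharted, hLie, β, hβ, normal_le_center_of_card_eq_two hβ.card_ker,
    factorsOverSpin_of_pinProj hE (φ := φ) (ψ.continuous.comp continuous_subtype_val)
    (fun x => by rw [hφ, hdet _ x.2]) fun x v => by rw [hφ]; exact hτ _ v⟩

end PinExtension

section Conclusion

variable {d : ℕ} {G : Type u} [TopologicalSpace G] [Group G]
  [ChartedSpace (EuclideanSpace ℝ (Fin d)) G] [LieGroup (𝓡 d) ∞ G] {K : Subgroup G} {θ : G ≃* G}
  {h : IsCartanInvolution d K θ} {B : LinearMap.BilinForm ℝ (GroupLieAlgebra (𝓡 d) G)}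

theorem exists_doubleCovering_of_coordinates (hB : IsInvariantForm d θ B)
    (hSO : ∀ k : K, AdP h k ∈ SO (q θ B)) {n : ℕ} [NeZero n] {W : Type*} [NormedAddCommGroup W]
    [NormedSpace ℝ W] [FiniteDimensional ℝ W]
    {Ψ : EuclideanSpace ℝ (Fin n) ≃ₗ[ℝ] p₀ d θ} {Ψ' : W ≃ₗ[ℝ] k₀ d θ}
    (hΨ : ∀ v w, B (Ψ v) (Ψ w) = inner ℝ v w) (hΨ' : ∀ w, B (Ψ' w) (Ψ' w) = -‖w‖ ^ 2) :
    ∃ (G' : Type u) (_ : TopologicalSpace G') (_ : Group G')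
      (_ : ChartedSpace (EuclideanSpace ℝ (Fin d)) G') (_ : LieGroup (𝓡 d) ∞ G')
      (β : G' →* G),
      IsDoubleCovering d β ∧ β.ker ≤ Subgroup.center G' ∧
        FactorsOverSpin (q θ B) ((AdP h).comp (β.subgroupComap K)) := by
  have hΨnorm (v) : B (Ψ v) (Ψ v) = ‖v‖ ^ 2 := (hΨ v v).trans (real_inner_self_eq_norm_sq v)
  let ρ := coneRep (cartanCoordinates Ψ Ψ' h) (Ad d) (form_Ad_cartanCoordinates hB hΨnorm hΨ')
  have hfst (k : K) (u) : ((ρ k).1 u).1 = Ψ.symm (AdReal h k (Ψ u.1)) :=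
    fst_symm_Ad_cartanCoordinates hB k u
  have hcorner (k : K) (v) : corner (ρ k).1 v = Ψ.symm (AdReal h k (Ψ v)) := hfst k (v, 0)
  have hdet (k : K) : LinearMap.det
      (corner (ρ k).1 : EuclideanSpace ℝ (Fin n) →ₗ[ℝ] EuclideanSpace ℝ (Fin n)) = 1 := by
    rw [← det_AdReal (hSO k), ← LinearMap.det_conj (AdReal h k) Ψ.symm]
    exact congrArg _ (LinearMap.ext (hcorner k))
  have hnorm (k) (hk : k ∈ K) : ρ k ∈ fstIsometries n W := fun u =>
    (congrArg _ (hfst ⟨k, hk⟩ u)).trans (norm_symm_AdReal hB hΨnorm ⟨k, hk⟩ u.1)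
  have hτ (k : K) (v) : AdP h k (realVec (complexBasis Ψ) v)
      = realVec (complexBasis Ψ) (corner (ρ k).1 v) := by
    rw [realVec_complexBasis, realVec_complexBasis, hcorner, LinearEquiv.apply_symm_apply]
    rfl
  exact exists_doubleCovering_of_coneMonoidHom (isOrthonormalFor_complexBasis hB hΨ)
    (continuous_coneRep _ continuous_Ad_apply) hnorm (fun k hk => hdet ⟨k, hk⟩) hτ

end Conclusion

end DoubleCover

end

open DoubleCover in
theorem lemma4p3_general {d : ℕ} {G : Type u} [TopologicalSpace G] [Group G]
    [ChartedSpace (EuclideanSpace ℝ (Fin d)) G] [LieGroup (𝓡 d) ∞ G]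
    (K : Subgroup G) (θ : G ≃* G) (hθ : IsCartanInvolution d K θ)
    (B : LinearMap.BilinForm ℝ (GroupLieAlgebra (𝓡 d) G)) (hB : IsInvariantForm d θ B)
    (hSO : ∀ k : K, AdP hθ k ∈ SO (q θ B)) :
    ∃ (G' : Type u) (_ : TopologicalSpace G') (_ : Group G')
      (_ : ChartedSpace (EuclideanSpace ℝ (Fin d)) G') (_ : LieGroup (𝓡 d) ∞ G')
      (β : G' →* G),
      IsDoubleCovering d β ∧
      β.ker ≤ Subgroup.center G' ∧
      FactorsOverSpin (q θ B) ((AdP hθ).comp (β.subgroupComap K)) := by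
  obtain ⟨n, Ψ, hΨ⟩ := exists_isometry_of_pos_def (B.restrict (p₀ d θ)) (fun X Y => hB.symm X Y)
    fun X hX => hB.pos_def X X.2 fun h => hX (Subtype.ext h)
  obtain ⟨m, Ψ', hΨ'⟩ := exists_isometry_of_pos_def (-B.restrict (k₀ d θ))
    (fun X Y => congrArg Neg.neg (hB.symm X Y))
    fun X hX => neg_pos.2 (hB.neg_def X X.2 fun h => hX (Subtype.ext h))
  have hΨ'norm (w) : B (Ψ' w) (Ψ' w) = -‖w‖ ^ 2 :=
    neg_eq_iff_eq_neg.1 ((hΨ' w w).trans (real_inner_self_eq_norm_sq w))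
  obtain rfl | hn := eq_or_ne n 0
  · have : Subsingleton (P d θ) := (complexBasis Ψ).repr.toEquiv.subsingleton
    exact exists_doubleCovering_of_factorsOverSpin
      (factorsOverSpin_of_subsingleton (q θ B) (AdP hθ))
  · have : NeZero n := ⟨hn⟩
    exact exists_doubleCovering_of_coordinates hB hSO hΨ hΨ'norm

open DoubleCover in
theorem lemma4p3 {d : ℕ} {G : Type u} [TopologicalSpace G] [Group G]
    [ChartedSpace (EuclideanSpace ℝ (Fin d)) G] [LieGroup (𝓡 d) ∞ G]
    (K : Subgroup G) (θ : G ≃* G) (hθ : IsCartanInvolution d K θ)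
    (B : LinearMap.BilinForm ℝ (GroupLieAlgebra (𝓡 d) G)) (hB : IsInvariantForm d θ B)
    (hSO : ∀ k : K, AdP hθ k ∈ SO (q θ B))
    (hlift : ¬ FactorsOverSpin (q θ B) (AdP hθ)) :
    ∃ (G' : Type u) (_ : TopologicalSpace G') (_ : Group G')
      (_ : ChartedSpace (EuclideanSpace ℝ (Fin d)) G') (_ : LieGroup (𝓡 d) ∞ G')
      (β : G' →* G),
      IsDoubleCovering d β ∧
      β.ker ≤ Subgroup.center G' ∧
      FactorsOverSpin (q θ B) ((AdP hθ).comp (β.subgroupComap K)) :=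
  lemma4p3_general K θ hθ B hB hSO
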